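/- **Corollary 4.3 (invertibility criterion).** Let $1<p<\infty$ and $1/p+1/q=1$. On the unit circle $\mathbb T$ write $f_k=\frac1{2\pi}\int_0^{2\pi}f(e^{i\theta})e^{-ik\theta}\,d\theta$ for the Fourier coefficients of $f\in L^1(\mathbb T)$, $\tilde f(t)=f(t^{-1})$, and $H^r(\mathbb T)=\{f\in L^r(\mathbb T): f_k=0 \text{ for all } k<0\}$. Let $P:\sum_{k\in\mathbb Z}f_kt^k\mapsto\sum_{k\ge0}f_kt^k$ be the (bounded) Riesz projection on $L^p(\mathbb T)$, $L(a)f=af$ for $a\in L^\infty(\mathbb T)$, and $(Jf)(t)=t^{-1}f(t^{-1})$; the Toeplitz and Hankel operators on $H^p(\mathbb T)$ are $T(a)=PL(a)P|_{H^p(\mathbb T)}$ and $H(a)=PL(a)JP|_{H^p(\mathbb T)}$. Suppose that $a,b,c,d$ satisfy the basic factorization conditions in $H^p(\mathbb T)$ with indices $n,m\in\mathbb Z$, that is: (i) $a$ and $b$ are invertible elements of $L^\infty(\mathbb T)$, $a\tilde a=b\tilde b$, and $c=\dfrac ab=\dfrac{\tilde b}{\tilde a}$, $d=\dfrac{\tilde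 a}b=\dfrac{\tilde b}a$; (ii) there are functions $c_+,d_+$ on $\mathbb T$ with $$c(t)=c_+(t)\,t^{2n}\,c_+^{-1}(t^{-1}),\qquad d(t)=d_+(t)\,t^{2m}\,d_+^{-1}(t^{-1}),$$ $$(1+t)c_+(t)\in H^q(\mathbb T),\quad (1-t)c_+^{-1}(t)\in H^p(\mathbb T),\quad (1+t)d_+(t)\in H^p(\mathbb T),\quad (1-t)d_+^{-1}(t)\in H^q(\mathbb T).$$ For $n,m>0$ put $$\rho=t^{-m-n}(1+t)(1+t^{-1})\,\tilde c_+\tilde d_+\,b^{-1}\in L^1(\mathbb T),\qquad A_{n,m}=\bigl[\rho_{i-j}+\rho_{i+j}\bigr]_{0\le i\le n-1,\ 0\le j\le m-1}.$$ Assume that $T(a)+H(b)$ is a Fredholm operator on $H^p(\mathbb T)$. Then $T(a)+H(b)$ is invertible on $H^p(\mathbb T)$ if and only if either $n=m=0$, or $n=m>0$ and the matrix $A_{n,n}$ is invertible. -/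

import Mathlib

open MeasureTheory
open scoped ENNReal

noncomputable section

namespace ToeplitzHankel

/-- The unit circle, parametrized by `x ↦ t = e^{2πix}`, `x ∈ ℝ/ℤ`. In this parametrization
`t⁻¹` corresponds to `-x`, and the monomial `t ^ n` is `fourier n x`. -/
abbrev Torus : Type := UnitAddCircle

/-- Normalized Lebesgue (arc length) measure on the circle. -/
abbrev arc : Measure Torus := AddCircle.haarAddCircle

/-- `L^p(𝕋)`. -/
abbrev LpT (p : ℝ≥0∞) : Type := Lp ℂ p arc

/-- The function `t ^ n` on the circle. -/
def tpow (n : ℤ) : Torus → ℂ := fun x => fourier n x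

/-- `f̃(t) = f(t⁻¹)`. -/
def tilde (f : Torus → ℂ) : Torus → ℂ := fun x => f (-x)

/-- The function `f` represents an element of `H^p(𝕋)`. -/
def MemHardy (p : ℝ≥0∞) (f : Torus → ℂ) : Prop :=
  MemLp f p arc ∧ ∀ n : ℤ, n < 0 → fourierCoeff f n = 0

section Spaces

variable (p : ℝ≥0∞) [Fact (1 ≤ p)]

lemma integrable_LpT (f : LpT p) : Integrable f arc :=
  (Lp.memLp f).integrable Fact.out

/-- The Hardy space `H^p(𝕋)`, as a subspace of `L^p(𝕋)`. -/
def hardySpace : Submodule ℂ (LpT p) where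
  carrier := {f | ∀ n : ℤ, n < 0 → fourierCoeff (f : Torus → ℂ) n = 0}
  zero_mem' := by
    intro n _
    rw [fourierCoeff_congr_ae (Lp.coeFn_zero ℂ p arc)]
    simp [fourierCoeff]
  add_mem' := by
    intro f g hf hg n hn
    rw [fourierCoeff_congr_ae (Lp.coeFn_add f g),
      fourierCoeff.add (integrable_LpT p f) (integrable_LpT p g), Pi.add_apply, hf n hn, hg n hn,
      add_zero]
  smul_mem' := by
    intro c f hf n hn
    rw [fourierCoeff_congr_ae (Lp.coeFn_smul c f), fourierCoeff.const_smul, hf n hn, smul_zero]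

/-- `P` acts on Fourier series as `∑_{n ∈ ℤ} f_n t^n ↦ ∑_{n ≥ 0} f_n t^n`. -/
def IsRieszProjection (P : LpT p →L[ℂ] LpT p) : Prop :=
  ∀ (f : LpT p) (n : ℤ), fourierCoeff (P f : Torus → ℂ) n =
    if 0 ≤ n then fourierCoeff (f : Torus → ℂ) n else 0

open scoped Classical in
/-- The Riesz projection on `L^p(𝕋)`: the bounded operator that acts on Fourier series as
`∑_{n ∈ ℤ} f_n t^n ↦ ∑_{n ≥ 0} f_n t^n`. There is exactly one such operator if `1 < p < ∞`
(M. Riesz), and these are the only exponents for which this definition is used. -/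
def rieszProjection : LpT p →L[ℂ] LpT p :=
  if h : ∃ P : LpT p →L[ℂ] LpT p, IsRieszProjection p P then h.choose else 0

lemma rieszProjection_mem (f : LpT p) : rieszProjection p f ∈ hardySpace p := by
  unfold rieszProjection
  split_ifs with h
  · intro n hn
    rw [h.choose_spec f n, if_neg (not_le.mpr hn)]
  · exact (hardySpace p).zero_mem

/-- The multiplication operator `L(a) : f ↦ a f` on `L^p(𝕋)`, for `a ∈ L^∞(𝕋)`. -/
def mulOp (a : LpT ∞) : LpT p →L[ℂ] LpT p :=
  (ContinuousLinearMap.mul ℂ ℂ).holderL arc ∞ p p a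

lemma measurePreserving_neg_arc : MeasurePreserving (fun x : Torus => -x) arc arc :=
  Measure.measurePreserving_neg arc

/-- The operator `f(t) ↦ f(t⁻¹)` on `L^p(𝕋)`. -/
def reflOp : LpT p →L[ℂ] LpT p :=
  (Lp.compMeasurePreservingₗᵢ ℂ (fun x : Torus => -x)
    measurePreserving_neg_arc).toContinuousLinearMap

/-- The flip operator `J : f(t) ↦ t⁻¹ f(t⁻¹)` on `L^p(𝕋)`. -/
def flipOp : LpT p →L[ℂ] LpT p :=
  mulOp p (fourierLp ∞ (-1)) ∘L reflOp p

/-- The compression `P B` restricted to `H^p(𝕋)` of an operator `B` on `L^p(𝕋)`, as an operator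
from `H^p(𝕋)` into itself. -/
def compression (B : LpT p →L[ℂ] LpT p) : hardySpace p →L[ℂ] hardySpace p :=
  (rieszProjection p ∘L B ∘L (hardySpace p).subtypeL).codRestrict (hardySpace p)
    (fun _ => rieszProjection_mem p _)

/-- The Toeplitz operator `T(a) = P L(a) P` on `H^p(𝕋)`. -/
def toeplitz (a : LpT ∞) : hardySpace p →L[ℂ] hardySpace p :=
  compression p (mulOp p a)

/-- The Hankel operator `H(a) = P L(a) J P` on `H^p(𝕋)`. -/
def hankel (a : LpT ∞) : hardySpace p →L[ℂ] hardySpace p :=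
  compression p (mulOp p a ∘L flipOp p)

end Spaces

/-- `a ∈ G L^∞(𝕋)`: the element `a` is invertible in the algebra `L^∞(𝕋)`. -/
def IsUnitLinf (a : LpT ∞) : Prop :=
  ∃ a' : LpT ∞, ∀ᵐ x ∂arc, a x * a' x = 1

/-- The functions `a, b, c, d` satisfy the basic factorization conditions in `H^p(𝕋)`, with
indices `n, m` and factors `c₊, d₊`; here `1/p + 1/q = 1`. -/
structure BasicFactorization (p q : ℝ≥0∞) (a b c d : LpT ∞) (n m : ℤ) (cp dp : Torus → ℂ) :
    Prop where
  unit_a : IsUnitLinf a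
  unit_b : IsUnitLinf b
  compat : ∀ᵐ x ∂arc, a x * tilde a x = b x * tilde b x
  c_eq : ∀ᵐ x ∂arc, c x = a x / b x
  c_eq' : ∀ᵐ x ∂arc, c x = tilde b x / tilde a x
  d_eq : ∀ᵐ x ∂arc, d x = tilde a x / b x
  d_eq' : ∀ᵐ x ∂arc, d x = tilde b x / a x
  cp_ne_zero : ∀ᵐ x ∂arc, cp x ≠ 0
  dp_ne_zero : ∀ᵐ x ∂arc, dp x ≠ 0
  c_factor : ∀ᵐ x ∂arc, c x = cp x * tpow (2 * n) x * (tilde cp x)⁻¹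
  d_factor : ∀ᵐ x ∂arc, d x = dp x * tpow (2 * m) x * (tilde dp x)⁻¹
  cp_mem : MemHardy q (fun x => (1 + tpow 1 x) * cp x)
  cp_inv_mem : MemHardy p (fun x => (1 - tpow 1 x) * (cp x)⁻¹)
  dp_mem : MemHardy p (fun x => (1 + tpow 1 x) * dp x)
  dp_inv_mem : MemHardy q (fun x => (1 - tpow 1 x) * (dp x)⁻¹)

/-- `ρ = t^{-m-n} (1 + t) (1 + t⁻¹) c̃₊ d̃₊ b⁻¹`. -/
def rho (b : LpT ∞) (n m : ℤ) (cp dp : Torus → ℂ) : Torus → ℂ := fun x =>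
  tpow (-m - n) x * (1 + tpow 1 x) * (1 + tpow (-1) x) * tilde cp x * tilde dp x * (b x)⁻¹

/-- The matrix `A_{n,m} = [ρ_{i-j} + ρ_{i+j}]`, `0 ≤ i < n`, `0 ≤ j < m`
(used for `n, m > 0` only). -/
def matrixA (b : LpT ∞) (n m : ℤ) (cp dp : Torus → ℂ) :
    Matrix (Fin n.toNat) (Fin m.toNat) ℂ :=
  Matrix.of fun i j =>
    fourierCoeff (rho b n m cp dp) ((i : ℤ) - (j : ℤ)) +
      fourierCoeff (rho b n m cp dp) ((i : ℤ) + (j : ℤ))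

end ToeplitzHankel

end

/-!
The operator `T(a) + H(b)` is invertible exactly when it is bijective, and everything is reduced
to the case of vanishing indices.

**The kernel equation.** `(T(a) + H(b)) f = 0` says that `F = a f + b J f` has no nonnegative
Fourier coefficients, i.e. that `h = J F` is in the Hardy space. The relation `a ã = b b̃` gives
`h = d J h`, and the factorization of `d` turns this into the statement that `v = (1 - t) t^{-m}
d₊⁻¹ h` is odd, `v(t⁻¹) = -v(t)`. As `(1 - t) d₊⁻¹ h` is a product of functions in `H^q` and
`H^p`, the spectrum of `v` is bounded below by `-m`, hence contained in `[-m, m]`; an odd Laurent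
polynomial is `-(t - t⁻¹)` times an even one, `w` (`exists_even_polynomial`). In the same way `V =
(1 + t) tⁿ c₊ f` has even part `V + Ṽ = ρ w` (`ae_even_part`), which is where the matrix `[ρ_{i-j}
+ ρ_{i+j}]` comes from. In particular the operator is injective if `n ≥ 0` and `m ≤ 0`
(`ae_eq_zero_of_analytic_part`).

**Vanishing indices.** The transposed operator `T(ã) + H(b)` on `H^q` is of the same kind with `c`
and `d` interchanged (`transpose`). So for `n = m = 0` both the operator and its transpose are
injective. If the range has finite codimension, it is closed, and a functional annihilating it is
represented by a function in `H^q` (through `(L^p)' = L^q`, proved here from the Radon–Nikodym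
theorem) in the kernel of the transpose. Hence the operator is bijective
(`bijective_of_index_zero`).

**General indices.** If `n < 0` there is an explicit kernel function, and if `m < 0 ≤ n` the
constants are not in the range. For `n, m ≥ 0` one has `T(a) + H(b) = T(t^{-m}) M₀ T(tⁿ)` where
`M₀ = T(t^{m-n} a) + H(t^{m+n} b)` has vanishing indices and, as `T(a) + H(b)` is Fredholm, a
range of finite codimension; so `M₀` is bijective. Linear algebra (`bijective_comp_iff`) shows
that `T(a) + H(b)` is bijective exactly when the compression of `M₀⁻¹` to a map from polynomials
of degree less than `m` to jets of order `n` is. This forces `n = m`, and for `n = m > 0` the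
kernel equation identifies the compression with the matrix `A` up to invertible factors
(`exists_matrixA_mulVec`).

The boundedness of the Riesz projection is not needed as a separate input: were there no bounded
projection, the operators would vanish and could not be Fredholm
(`exists_rieszProjection_of_isFredholm`).
-/

noncomputable section

namespace ToeplitzHankel

/-! ### Fourier coefficients on the circle -/

lemma tpow_eq_zpow (n : ℤ) (x : Torus) : tpow n x = tpow 1 x ^ n := by
  simp [tpow, fourier_apply, AddCircle.toCircle_zsmul]

lemma tpow_ne_zero (n : ℤ) (x : Torus) : tpow n x ≠ 0 := by
  simp [tpow, fourier_apply]

lemma tpow_neg_arg (n : ℤ) (x : Torus) : tpow n (-x) = tpow (-n) x := by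
  simp [tpow, fourier_apply]

lemma tpow_zero (x : Torus) : tpow 0 x = 1 := by simp [tpow]

lemma tpow_add (m n : ℤ) (x : Torus) : tpow (m + n) x = tpow m x * tpow n x := by
  simp only [tpow]; exact fourier_add

lemma continuous_tpow (n : ℤ) : Continuous (tpow n) := map_continuous (fourier n)

lemma norm_tpow (n : ℤ) (x : Torus) : ‖tpow n x‖ = 1 := by
  simp [tpow, fourier_apply, Circle.norm_coe]

lemma tilde_tilde (f : Torus → ℂ) : tilde (tilde f) = f := by
  funext x; simp [tilde]

lemma ae_neg {P : Torus → Prop} (h : ∀ᵐ x ∂arc, P x) : ∀ᵐ x ∂arc, P (-x) :=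
  measurePreserving_neg_arc.quasiMeasurePreserving.ae h

lemma ae_tpow_one_ne (z : ℂ) : ∀ᵐ x ∂arc, tpow 1 x ≠ z := by
  have hsub : {x : Torus | tpow 1 x = z}.Subsingleton := by
    intro x hx y hy
    have : tpow 1 x = tpow 1 y := by rw [hx, hy]
    simp only [tpow, fourier_one] at this
    exact AddCircle.injective_toCircle one_ne_zero (Subtype.ext this)
  have h0 : arc {x : Torus | tpow 1 x = z} = 0 := by
    have : (volume : Measure Torus) {x : Torus | tpow 1 x = z} = 0 := by
      obtain h | ⟨y, h⟩ := hsub.eq_empty_or_singleton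
      · rw [h, measure_empty]
      · rw [h, ← Metric.closedBall_zero, AddCircle.volume_closedBall]; simp
    rw [AddCircle.volume_eq_smul_haarAddCircle] at this
    simpa using this
  rw [ae_iff]; simpa using h0

lemma ae_one_sub_ne_zero : ∀ᵐ x ∂arc, 1 - tpow 1 x ≠ 0 := by
  filter_upwards [ae_tpow_one_ne 1] with x hx h
  exact hx (by linear_combination -h)

lemma ae_one_add_ne_zero : ∀ᵐ x ∂arc, 1 + tpow 1 x ≠ 0 := by
  filter_upwards [ae_tpow_one_ne (-1)] with x hx h
  exact hx (by linear_combination h)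

lemma fourierCoeff_tpow_mul (k : ℤ) (f : Torus → ℂ) (n : ℤ) :
    fourierCoeff (fun x => tpow k x * f x) n = fourierCoeff f (n - k) := by
  unfold fourierCoeff
  congr 1; funext x
  have : (fourier (-(n - k)) x : ℂ) = fourier (-n) x * fourier k x := by
    rw [← fourier_add, neg_sub, sub_eq_neg_add]
  simp only [smul_eq_mul, this, tpow]; ring

lemma fourierCoeff_tilde (f : Torus → ℂ) (n : ℤ) :
    fourierCoeff (tilde f) n = fourierCoeff f (-n) := by
  unfold fourierCoeff
  rw [← measurePreserving_neg_arc.integral_comp' (f := MeasurableEquiv.neg Torus)]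
  congr 1; funext x
  have : fourier (-n) (-x) = (fourier n x : ℂ) := by
    have := tpow_neg_arg (-n) x
    rwa [neg_neg] at this
  simp only [tilde, MeasurableEquiv.neg_apply, neg_neg]
  rw [this]

lemma fourierCoeff_tpow (k n : ℤ) : fourierCoeff (tpow k) n = if n = k then 1 else 0 := by
  have := fourierCoeff_fourier (T := 1) k
  have h2 := congrFun this n
  simp only [Pi.single_apply] at h2
  exact h2

/-- An integrable function on the circle all of whose Fourier coefficients vanish is zero a.e. -/
lemma ae_eq_zero_of_fourierCoeff {f : Torus → ℂ} (hf : Integrable f arc)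
    (h : ∀ n, fourierCoeff f n = 0) : f =ᵐ[arc] 0 := by
  have hint : ∀ φ : C(Torus, ℂ), Integrable (fun x => φ x * f x) arc := fun φ =>
    hf.bdd_mul (c := ‖φ‖) φ.continuous.aestronglyMeasurable
      (ae_of_all _ fun x => φ.norm_coe_le_norm x)
  -- The functional `φ ↦ ∫ φ f` is continuous on `C(𝕋)` and vanishes on trigonometric polynomials.
  let Λ : C(Torus, ℂ) →L[ℂ] ℂ := LinearMap.mkContinuous
    { toFun := fun φ => ∫ x, φ x * f x ∂arc
      map_add' := fun φ ψ => by
        simp only [ContinuousMap.add_apply, add_mul]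
        exact integral_add (hint φ) (hint ψ)
      map_smul' := fun c φ => by
        simp only [ContinuousMap.smul_apply, smul_eq_mul, mul_assoc, RingHom.id_apply]
        exact integral_const_mul c _ } (∫ x, ‖f x‖ ∂arc) (fun φ => by
          simp only [LinearMap.coe_mk, AddHom.coe_mk]
          refine (norm_integral_le_integral_norm _).trans ?_
          rw [mul_comm, ← integral_const_mul]
          refine integral_mono (hint φ).norm (hf.norm.const_mul _) fun x => ?_
          simp only [norm_mul]
          exact mul_le_mul_of_nonneg_right (φ.norm_coe_le_norm x) (norm_nonneg _))
  have hker : (⊤ : Submodule ℂ C(Torus, ℂ)) ≤ Λ.ker := by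
    rw [← span_fourier_closure_eq_top]
    refine Submodule.topologicalClosure_minimal _ (Submodule.span_le.2 ?_) Λ.isClosed_ker
    rintro _ ⟨n, rfl⟩
    have := h (-n)
    simp only [fourierCoeff, neg_neg, smul_eq_mul] at this
    exact this
  have hzero : ∀ φ : C(Torus, ℂ), ∫ x, φ x * f x ∂arc = 0 := fun φ =>
    hker (Submodule.mem_top (x := φ))
  -- Indicators of closed sets are bounded pointwise limits of continuous functions.
  refine ae_eq_zero_of_forall_setIntegral_isClosed_eq_zero hf fun s hs => ?_
  obtain ⟨δ, -, hδ, hδ0⟩ := exists_seq_strictAnti_tendsto (0 : ℝ)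
  have htend := thickenedIndicator_tendsto_indicator_closure hδ hδ0 s
  rw [hs.closure_eq, tendsto_pi_nhds] at htend
  rw [← integral_indicator hs.measurableSet]
  refine tendsto_nhds_unique (tendsto_integral_of_dominated_convergence
    (F := fun k x => (((thickenedIndicator (hδ k) s x : NNReal) : ℝ) : ℂ) * f x)
    (fun x => ‖f x‖) ?_ hf.norm ?_ ?_) ?_
  · intro k
    exact (Complex.continuous_ofReal.comp (NNReal.continuous_coe.comp
      (thickenedIndicator (hδ k) s).continuous)).aestronglyMeasurable.mul hf.1
  · intro k
    refine ae_of_all _ fun x => ?_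
    rw [norm_mul]
    refine mul_le_of_le_one_left (norm_nonneg _) ?_
    simpa using thickenedIndicator_le_one (hδ k) s x
  · refine ae_of_all _ fun x => ?_
    have h1 := (NNReal.continuous_coe.tendsto _).comp (htend x)
    have h2 := ((Complex.continuous_ofReal.tendsto _).comp h1).mul_const (f x)
    refine h2.congr' (Filter.Eventually.of_forall fun k => rfl) |>.trans_eq ?_
    by_cases hx : x ∈ s <;> simp [hx]
  · have : ∀ k, ∫ x, (((thickenedIndicator (hδ k) s x : NNReal) : ℝ) : ℂ) * f x ∂arc = 0 :=
      fun k => hzero ⟨fun x => (((thickenedIndicator (hδ k) s x : NNReal) : ℝ) : ℂ),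
        Complex.continuous_ofReal.comp (NNReal.continuous_coe.comp
          (thickenedIndicator (hδ k) s).continuous)⟩
    simp only [this]; exact tendsto_const_nhds

lemma fourierCoeff_add' {f g : Torus → ℂ} (hf : Integrable f arc) (hg : Integrable g arc) (n : ℤ) :
    fourierCoeff (fun x => f x + g x) n = fourierCoeff f n + fourierCoeff g n :=
  congrFun (fourierCoeff.add hf hg) n

lemma fourierCoeff_sub' {f g : Torus → ℂ} (hf : Integrable f arc) (hg : Integrable g arc) (n : ℤ) :
    fourierCoeff (fun x => f x - g x) n = fourierCoeff f n - fourierCoeff g n := by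
  have h := fourierCoeff_add' hf (hg.const_mul (-1)) n
  rw [fourierCoeff.const_mul] at h
  simpa [sub_eq_add_neg] using h

lemma fourierCoeff_sum' {ι : Type*} (s : Finset ι) (f : ι → Torus → ℂ)
    (hf : ∀ i ∈ s, Integrable (f i) arc) (n : ℤ) :
    fourierCoeff (fun x => ∑ i ∈ s, f i x) n = ∑ i ∈ s, fourierCoeff (f i) n := by
  have h := congrFun (fourierCoeff.sum s f hf) n
  have e : (∑ i ∈ s, f i) = fun x => ∑ i ∈ s, f i x := by funext x; simp
  rw [e] at h
  simpa using h

/-- Integrable functions on the circle are determined by their Fourier coefficients. -/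
lemma ae_eq_of_fourierCoeff {f g : Torus → ℂ} (hf : Integrable f arc) (hg : Integrable g arc)
    (h : ∀ n, fourierCoeff f n = fourierCoeff g n) : f =ᵐ[arc] g := by
  have := ae_eq_zero_of_fourierCoeff (hf.sub hg) (fun n => by
    rw [show f - g = fun x => f x - g x from rfl, fourierCoeff_sub' hf hg, h, sub_self])
  filter_upwards [this] with x hx
  simpa [sub_eq_zero] using hx

/-! ### Function-level operations on the circle -/

lemma memLp_tpow (n : ℤ) (r : ℝ≥0∞) : MemLp (tpow n) r arc :=
  MemLp.of_bound (continuous_tpow n).aestronglyMeasurable 1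
    (ae_of_all _ fun x => (norm_tpow n x).le)

lemma memLp_bdd_mul {r : ℝ≥0∞} {a f : Torus → ℂ} (ha : MemLp a ∞ arc) (hf : MemLp f r arc) :
    MemLp (fun x => a x * f x) r arc :=
  MemLp.mul (p := ∞) (q := r) hf ha

lemma memLp_tilde {r : ℝ≥0∞} {f : Torus → ℂ} (hf : MemLp f r arc) :
    MemLp (tilde f) r arc :=
  hf.comp_measurePreserving measurePreserving_neg_arc

/-- The flip `f(t) ↦ t⁻¹ f(t⁻¹)` on functions. -/
def flip (f : Torus → ℂ) : Torus → ℂ := fun x => tpow (-1) x * tilde f x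

lemma fourierCoeff_flip (f : Torus → ℂ) (n : ℤ) :
    fourierCoeff (flip f) n = fourierCoeff f (-1 - n) := by
  unfold flip
  rw [fourierCoeff_tpow_mul, fourierCoeff_tilde]; congr 1; ring

lemma memLp_flip {r : ℝ≥0∞} {f : Torus → ℂ} (hf : MemLp f r arc) :
    MemLp (flip f) r arc :=
  memLp_bdd_mul (memLp_tpow _ _) (memLp_tilde hf)

section

/-! ### Products of Hardy functions -/

lemma MemHardy.congr {r : ℝ≥0∞} {f g : Torus → ℂ} (hf : MemHardy r f) (h : f =ᵐ[arc] g) :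
    MemHardy r g :=
  ⟨hf.1.ae_eq h, fun n hn => by rw [← fourierCoeff_congr_ae h]; exact hf.2 n hn⟩

lemma MemHardy.tpow_mul {r : ℝ≥0∞} {f : Torus → ℂ} (hf : MemHardy r f) {k : ℤ} (hk : 0 ≤ k) :
    MemHardy r (fun x => tpow k x * f x) :=
  ⟨memLp_bdd_mul (memLp_tpow _ _) hf.1, fun n hn => by
    rw [fourierCoeff_tpow_mul]; exact hf.2 _ (by omega)⟩

lemma integrable_mul_conj {p q : ℝ≥0∞} [hpq : p.HolderConjugate q] {g k : Torus → ℂ}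
    (hg : MemLp g p arc) (hk : MemLp k q arc) : Integrable (fun x => g x * k x) arc :=
  memLp_one_iff_integrable.1 (MemLp.mul (p := p) (q := q) hk hg)

variable (p : ℝ≥0∞) [Fact (1 ≤ p)]

lemma isRieszProjection_rieszProjection (hP : ∃ P : LpT p →L[ℂ] LpT p, IsRieszProjection p P) :
    IsRieszProjection p (rieszProjection p) := by
  unfold rieszProjection
  rw [dif_pos hP]
  exact hP.choose_spec

variable {p}

lemma LpT_ext {f g : LpT p} (h : ∀ n, fourierCoeff (f : Torus → ℂ) n =
    fourierCoeff (g : Torus → ℂ) n) : f = g :=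
  Lp.ext (ae_eq_of_fourierCoeff (integrable_LpT p f) (integrable_LpT p g) h)

lemma fourierCoeff_fourierLp (k n : ℤ) :
    fourierCoeff (fourierLp p k : Torus → ℂ) n = if n = k then 1 else 0 := by
  rw [fourierCoeff_congr_ae (coeFn_fourierLp p k)]
  exact fourierCoeff_tpow k n

/-- Multiplication maps `H^p × H^q` into functions with vanishing negative Fourier coefficients. -/
def HardyMul (p q : ℝ≥0∞) : Prop :=
  ∀ g k : Torus → ℂ, MemHardy p g → MemHardy q k →
    ∀ l : ℤ, l < 0 → fourierCoeff (fun x => g x * k x) l = 0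

lemma HardyMul.symm {p q : ℝ≥0∞} (h : HardyMul p q) : HardyMul q p := fun g k hg hk l hl => by
  simpa only [mul_comm] using h k g hk hg l hl

/-- The functional `f ↦ ∫ (P f) k t^{-l}` vanishes on all monomials, hence on `L^p`. -/
lemma hardyMul_of_rieszProjection {q : ℝ≥0∞} (hp_top : p ≠ ∞) [hpq : p.HolderConjugate q]
    (hP : ∃ P : LpT p →L[ℂ] LpT p, IsRieszProjection p P) : HardyMul p q := by
  obtain ⟨P, hP⟩ := hP
  intro g k hg hk l hl
  have hq : Fact (1 ≤ q) := ⟨(ENNReal.HolderConjugate.symm (p := p) (q := q)).one_le⟩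
  let κ : LpT q := (memLp_bdd_mul (memLp_tpow (-l) ∞) hk.1).toLp
  have hκ : (κ : Torus → ℂ) =ᵐ[arc] fun x => tpow (-l) x * k x := MemLp.coeFn_toLp _
  let Λ : LpT p →L[ℂ] ℂ := ((ContinuousLinearMap.mul ℂ ℂ).lpPairing arc p q).flip κ ∘L P
  have hΛ : ∀ f, Λ f = ∫ x, (P f : Torus → ℂ) x * (tpow (-l) x * k x) ∂arc := fun f => by
    simp only [Λ, ContinuousLinearMap.comp_apply, ContinuousLinearMap.flip_apply,
      ContinuousLinearMap.lpPairing_eq_integral, ContinuousLinearMap.mul_apply']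
    refine integral_congr_ae ?_
    filter_upwards [hκ] with x hx
    rw [hx]
  have hker : (⊤ : Submodule ℂ (LpT p)) ≤ Λ.ker := by
    rw [← span_fourierLp_closure_eq_top hp_top]
    refine Submodule.topologicalClosure_minimal _ (Submodule.span_le.2 ?_) Λ.isClosed_ker
    rintro _ ⟨j, rfl⟩
    change Λ (fourierLp p j) = 0
    rw [hΛ]
    by_cases hj : 0 ≤ j
    · have : P (fourierLp p j) = fourierLp p j := LpT_ext fun n => by
        rw [hP, fourierCoeff_fourierLp]; split_ifs <;> first | rfl | omega
      rw [this]
      have h2 := hk.2 (l - j) (by omega)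
      rw [← h2]
      refine integral_congr_ae ?_
      filter_upwards [coeFn_fourierLp p j] with x hx
      rw [hx, smul_eq_mul, ← mul_assoc, neg_sub, sub_eq_add_neg, fourier_add]; rfl
    · have : P (fourierLp p j) = 0 := LpT_ext fun n => by
        rw [hP, fourierCoeff_fourierLp, fourierCoeff_congr_ae (Lp.coeFn_zero ℂ p arc)]
        have : fourierCoeff (0 : Torus → ℂ) n = 0 := by simp [fourierCoeff]
        rw [this]
        split_ifs <;> first | rfl | omega
      rw [this]
      refine integral_eq_zero_of_ae ?_
      filter_upwards [Lp.coeFn_zero ℂ p arc] with x hx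
      rw [hx, Pi.zero_apply, zero_mul]
  have hG : P (hg.1.toLp) = hg.1.toLp := LpT_ext fun n => by
    rw [hP, fourierCoeff_congr_ae hg.1.coeFn_toLp]
    split_ifs with h
    · rfl
    · exact (hg.2 n (by omega)).symm
  have h0 : Λ hg.1.toLp = 0 := hker (Submodule.mem_top)
  rw [hΛ, hG] at h0
  rw [← h0]
  refine integral_congr_ae ?_
  filter_upwards [hg.1.coeFn_toLp] with x hx
  rw [hx, smul_eq_mul]
  simp only [tpow]; ring

variable {q : ℝ≥0∞}

/-- The Cauchy product formula for the Fourier coefficients of a product of Hardy functions. -/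
lemma HardyMul.fourierCoeff_mul [hpq : p.HolderConjugate q] (h : HardyMul p q)
    {g k : Torus → ℂ} (hg : MemHardy p g) (hk : MemHardy q k) (i : ℕ) :
    fourierCoeff (fun x => g x * k x) i =
      ∑ j ∈ Finset.range (i + 1), fourierCoeff g j * fourierCoeff k ((i : ℤ) - j) := by
  -- Split `g` into its Taylor polynomial of degree `i` and a remainder in `t^{i+1} H^p`.
  have hone : (1 : ℝ≥0∞) ≤ p := Fact.out
  set pol : Torus → ℂ := fun x => ∑ j ∈ Finset.range (i + 1), fourierCoeff g j * tpow j x with hpol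
  have hpolint : ∀ j ∈ Finset.range (i + 1),
      MemLp (fun x => fourierCoeff g (j : ℤ) * tpow (j : ℤ) x) p arc := fun j _ =>
    (memLp_tpow _ _).const_mul _
  have hpolm : MemLp pol p arc := memLp_finsetSum _ hpolint
  have hpolc : ∀ n : ℤ, fourierCoeff pol n = if 0 ≤ n ∧ n ≤ i then fourierCoeff g n else 0 := by
    intro n
    rw [hpol, fourierCoeff_sum' _ _ (fun j hj => (hpolint j hj).integrable hone)]
    simp only [fourierCoeff.const_mul, fourierCoeff_tpow]
    split_ifs with hn
    · lift n to ℕ using hn.1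
      rw [Finset.sum_eq_single n]
      · simp
      · intro b _ hb
        rw [if_neg (by exact_mod_cast hb.symm), mul_zero]
      · intro hn'; simp only [Finset.mem_range] at hn'; omega
    · refine Finset.sum_eq_zero fun j hj => ?_
      simp only [Finset.mem_range] at hj
      rw [if_neg (by omega), mul_zero]
  have hrem : MemHardy p (fun x => tpow (-(i + 1)) x * (g x - pol x)) := by
    refine ⟨memLp_bdd_mul (memLp_tpow _ _) (hg.1.sub hpolm), fun n hn => ?_⟩
    rw [fourierCoeff_tpow_mul, fourierCoeff_sub' (hg.1.integrable hone) (hpolm.integrable hone),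
      hpolc]
    split_ifs with h'
    · ring
    · rw [hg.2 _ (by omega), sub_zero]
  have hgp : MemLp (fun x => g x - pol x) p arc := hg.1.sub hpolm
  have h1 := h _ _ hrem hk (-1) (by norm_num)
  have h2 : fourierCoeff (fun x => (g x - pol x) * k x) i = 0 := by
    have e : (fun x => (tpow (-(i + 1)) x * (g x - pol x)) * k x) =
        fun x => tpow (-(i + 1)) x * ((g x - pol x) * k x) := by funext x; ring
    rw [e, fourierCoeff_tpow_mul] at h1
    rw [← h1]; congr 1; ring
  have e : (fun x => g x * k x) = fun x => (g x - pol x) * k x + pol x * k x := by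
    funext x; ring
  rw [e, fourierCoeff_add' (integrable_mul_conj hgp hk.1) (integrable_mul_conj hpolm hk.1), h2,
    zero_add]
  have e2 : (fun x => pol x * k x) = fun x => ∑ j ∈ Finset.range (i + 1),
      fourierCoeff g j * (tpow j x * k x) := by
    funext x; simp only [hpol, Finset.sum_mul, mul_assoc]
  have hq : 1 ≤ q := (ENNReal.HolderConjugate.symm (p := p) (q := q)).one_le
  rw [e2, fourierCoeff_sum']
  · simp only [fourierCoeff.const_mul, fourierCoeff_tpow_mul]
  · intro j _
    exact ((memLp_bdd_mul (memLp_tpow _ _) hk.1).integrable hq).const_mul _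

/-! ### Odd functions with half-bounded spectrum -/

lemma ae_eq_zero_of_odd {v : Torus → ℂ} (hv : Integrable v arc)
    (hodd : ∀ᵐ x ∂arc, tilde v x = - v x) (h : ∀ n : ℤ, n < 0 → fourierCoeff v n = 0) :
    v =ᵐ[arc] 0 := by
  have hco : ∀ n, fourierCoeff v (-n) = - fourierCoeff v n := fun n => by
    rw [← fourierCoeff_tilde, fourierCoeff_congr_ae hodd]
    have := fourierCoeff.const_mul v (-1) n
    simpa using this
  refine ae_eq_zero_of_fourierCoeff hv fun n => ?_
  rcases lt_trichotomy n 0 with hn | rfl | hn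
  · exact h n hn
  · have := hco 0
    rw [neg_zero] at this
    exact self_eq_neg.1 this
  · have := hco n
    rw [h (-n) (by omega)] at this
    exact neg_eq_zero.1 this.symm

/-- An odd integrable function whose Fourier coefficients vanish below `-m` is
`-(t - t⁻¹)` times an even Laurent polynomial of degree less than `m`. -/
lemma exists_even_factor (m : ℕ) : ∀ {v : Torus → ℂ}, Integrable v arc →
    (∀ᵐ x ∂arc, tilde v x = - v x) → (∀ n : ℤ, n < -m → fourierCoeff v n = 0) →
    ∃ y : ℕ → ℂ, ∀ᵐ x ∂arc, v x = -(tpow 1 x - tpow (-1) x) *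
      ∑ j ∈ Finset.range m, y j * (tpow j x + tpow (-j) x) := by
  induction m with
  | zero =>
    intro v hv hodd h
    refine ⟨0, ?_⟩
    filter_upwards [ae_eq_zero_of_odd hv hodd (fun n hn => h n (by simpa using hn))] with x hx
    simpa using hx
  | succ m ih =>
    intro v hv hodd h
    -- Subtracting a multiple of `e` removes the lowest coefficient of `v`. The lowest coefficient
    -- of `e` is `2` for `m = 0`, where `t^m` and `t^{-m}` coincide, and `1` otherwise.
    set e : Torus → ℂ := fun x => -(tpow 1 x - tpow (-1) x) * (tpow m x + tpow (-m) x) with he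
    have he' : e = fun x => ((tpow (-1 + m) x + tpow (-1 - m) x) - tpow (1 + m) x)
        - tpow (1 - m) x := by
      funext x
      simp only [he, sub_eq_add_neg, tpow_add]; ring
    have ht : ∀ k, Integrable (tpow k) arc := fun k =>
      memLp_one_iff_integrable.1 (memLp_tpow k 1)
    have ht2 : Integrable (fun x => tpow (-1 + m) x + tpow (-1 - m) x) arc := (ht _).add (ht _)
    have ht3 : Integrable (fun x => tpow (-1 + m) x + tpow (-1 - m) x - tpow (1 + m) x) arc :=
      ht2.sub (ht _)
    have heint : Integrable e arc := by
      rw [he']; exact ht3.sub (ht _)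
    have hec : ∀ n : ℤ, fourierCoeff e n = (if n = -1 + m then 1 else 0) +
        (if n = -1 - m then 1 else 0) - (if n = 1 + m then 1 else 0)
          - (if n = 1 - m then 1 else 0) := fun n => by
      rw [he', fourierCoeff_sub' ht3 (ht _), fourierCoeff_sub' ht2 (ht _),
        fourierCoeff_add' (ht _) (ht _)]
      simp only [fourierCoeff_tpow]
    have hne : fourierCoeff e (-1 - m) ≠ 0 := by
      rw [hec, if_pos rfl, if_neg (show ¬ (-1 - (m : ℤ) = 1 + m) by omega),
        if_neg (show ¬ (-1 - (m : ℤ) = 1 - m) by omega)]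
      split_ifs <;> norm_num
    set γ := fourierCoeff v (-1 - m) / fourierCoeff e (-1 - m) with hγ
    have hodde : ∀ x, tilde e x = - e x := fun x => by
      simp only [tilde, he, tpow_neg_arg, neg_neg]; ring
    obtain ⟨y, hy⟩ := ih (v := fun x => v x - γ * e x) (hv.sub (heint.const_mul _))
      (by
        filter_upwards [hodd] with x hx
        have := hodde x
        simp only [tilde] at hx this ⊢
        rw [hx, this]; ring)
      (by
        intro n hn
        rw [fourierCoeff_sub' hv (heint.const_mul _), fourierCoeff.const_mul]
        rcases eq_or_ne n (-1 - m) with rfl | hn'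
        · rw [hγ, div_mul_cancel₀ _ hne, sub_self]
        · rw [h n (by push_cast; omega), hec, if_neg (by omega), if_neg (by omega),
            if_neg (by omega), if_neg (by omega)]
          ring)
    refine ⟨fun j => if j = m then γ else y j, ?_⟩
    filter_upwards [hy] with x hx
    rw [Finset.sum_range_succ, if_pos rfl,
      Finset.sum_congr rfl (g := fun j => y j * (tpow j x + tpow (-j) x))
      (fun j hj => by rw [if_neg (by simp only [Finset.mem_range] at hj; omega)]), mul_add, ← hx]
    simp only [he]; ring

end

/-! ### The kernel equation -/

/-- The function `a f + b J f`, whose analytic part is `(T(a) + H(b)) f`. -/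
def thFun (a b f : Torus → ℂ) : Torus → ℂ := fun x => a x * f x + b x * flip f x

lemma memLp_thFun {r : ℝ≥0∞} (a b : LpT ∞) {f : Torus → ℂ} (hf : MemLp f r arc) :
    MemLp (thFun a b f) r arc :=
  (memLp_bdd_mul (Lp.memLp a) hf).add (memLp_bdd_mul (Lp.memLp b) (memLp_flip hf))

namespace BasicFactorization

variable {p q : ℝ≥0∞} {a b c d : LpT ∞} {n m : ℤ} {cp dp : Torus → ℂ}

lemma ae_a_ne_zero (h : BasicFactorization p q a b c d n m cp dp) : ∀ᵐ x ∂arc, a x ≠ 0 := by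
  obtain ⟨a', ha⟩ := h.unit_a
  filter_upwards [ha] with x hx h0
  simp [h0] at hx

lemma ae_b_ne_zero (h : BasicFactorization p q a b c d n m cp dp) : ∀ᵐ x ∂arc, b x ≠ 0 := by
  obtain ⟨b', hb⟩ := h.unit_b
  filter_upwards [hb] with x hx h0
  simp [h0] at hx

/-- The factorizations of `c` and `d`, with denominators cleared. -/
lemma ae_relations (h : BasicFactorization p q a b c d n m cp dp) : ∀ᵐ x ∂arc,
    (a x ≠ 0 ∧ b x ≠ 0 ∧ b (-x) ≠ 0 ∧ cp x ≠ 0 ∧ cp (-x) ≠ 0 ∧ dp x ≠ 0 ∧ dp (-x) ≠ 0) ∧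
    (dp (-x) * a (-x) = tpow m x ^ 2 * b x * dp x ∧ dp (-x) * b (-x) = tpow m x ^ 2 * a x * dp x) ∧
    (cp (-x) * a x = tpow n x ^ 2 * b x * cp x ∧
      cp (-x) * b (-x) = tpow n x ^ 2 * a (-x) * cp x) := by
  filter_upwards [h.ae_a_ne_zero, h.ae_b_ne_zero, ae_neg h.ae_a_ne_zero, ae_neg h.ae_b_ne_zero,
    h.d_eq, h.d_eq', h.d_factor, h.dp_ne_zero, ae_neg h.dp_ne_zero,
    h.c_eq, h.c_eq', h.c_factor, h.cp_ne_zero, ae_neg h.cp_ne_zero]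
    with x ha hb ha' hb' hd hd' hdf hdp hdp' hc hc' hcf hcp hcp'
  simp only [tilde] at hd hd' hdf hc hc' hcf
  rw [two_mul, tpow_add] at hdf hcf
  have e1 : a (-x) / b x = dp x * (tpow m x * tpow m x) * (dp (-x))⁻¹ := hd ▸ hdf
  have e2 : b (-x) / a x = dp x * (tpow m x * tpow m x) * (dp (-x))⁻¹ := hd' ▸ hdf
  have e3 : a x / b x = cp x * (tpow n x * tpow n x) * (cp (-x))⁻¹ := hc ▸ hcf
  have e4 : b (-x) / a (-x) = cp x * (tpow n x * tpow n x) * (cp (-x))⁻¹ := hc' ▸ hcf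
  refine ⟨⟨ha, hb, hb', hcp, hcp', hdp, hdp'⟩, ⟨?_, ?_⟩, ?_, ?_⟩
  · field_simp at e1; linear_combination e1
  · field_simp at e2; linear_combination e2
  · field_simp at e3; linear_combination e3
  · field_simp at e4; linear_combination e4

/-- The odd function attached to a solution of the kernel equation: if `F = a f + b J f` then
`h = J F` satisfies `h = d J h`, so that `(1 - t) t^{-m} d₊⁻¹ h` is odd. -/
lemma ae_odd_left (h : BasicFactorization p q a b c d n m cp dp) (f : Torus → ℂ) :
    ∀ᵐ x ∂arc, tilde (fun x => tpow (-m) x * (((1 - tpow 1 x) * (dp x)⁻¹) *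
        flip (thFun a b f) x)) x =
      - (tpow (-m) x * (((1 - tpow 1 x) * (dp x)⁻¹) * flip (thFun a b f) x)) := by
  filter_upwards [h.ae_relations] with x ⟨⟨ha, hb, hb', hcp, hcp', hdp, hdp'⟩, ⟨e1, e2⟩, _⟩
  have ht := tpow_ne_zero 1 x
  have hs := tpow_ne_zero m x
  simp only [tilde, flip, thFun, neg_neg, tpow_neg_arg]
  rw [tpow_eq_zpow (-m), tpow_eq_zpow (-1), zpow_neg, zpow_neg, zpow_one, ← tpow_eq_zpow]
  field_simp
  linear_combination (1 - tpow 1 x) * (tpow 1 x * f x * e2 + f (-x) * e1)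

/-- The odd function `(1 + t) tⁿ c₊ f` attached to a solution of `a f + b J f = 0`. -/
lemma ae_odd_right (h : BasicFactorization p q a b c d n m cp dp) {f : Torus → ℂ}
    (hf : thFun a b f =ᵐ[arc] 0) :
    ∀ᵐ x ∂arc, tilde (fun x => tpow n x * (((1 + tpow 1 x) * cp x) * f x)) x =
      - (tpow n x * (((1 + tpow 1 x) * cp x) * f x)) := by
  filter_upwards [h.ae_relations, hf] with x ⟨⟨ha, hb, hb', hcp, hcp', hdp, hdp'⟩, _, ⟨e1, e2⟩⟩ hx
  have ht := tpow_ne_zero 1 x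
  have hs := tpow_ne_zero n x
  simp only [tilde, flip, thFun, tpow_neg_arg, Pi.zero_apply] at hx ⊢
  rw [tpow_eq_zpow (-1), zpow_neg, zpow_one] at hx ⊢
  rw [tpow_eq_zpow (-n), zpow_neg, ← tpow_eq_zpow]
  field_simp at hx ⊢
  apply mul_left_cancel₀ hb
  linear_combination (1 + tpow 1 x) * cp (-x) * hx - (1 + tpow 1 x) * tpow 1 x * f x * e1

/-- If `(1 - t) t^{-m} d₊⁻¹ J F = -(t - t⁻¹) w` then `F = (1 + t⁻¹) t^{-m} d̃₊ w`,
where `F = a f + b J f`. -/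
lemma ae_thFun_eq (h : BasicFactorization p q a b c d n m cp dp) {f w : Torus → ℂ}
    (hw : ∀ x, w (-x) = w x)
    (hv : ∀ᵐ x ∂arc, tpow (-m) x * (((1 - tpow 1 x) * (dp x)⁻¹) * flip (thFun a b f) x) =
      -(tpow 1 x - tpow (-1) x) * w x) :
    ∀ᵐ x ∂arc, thFun a b f x = (1 + tpow (-1) x) * tpow (-m) x * dp (-x) * w x := by
  filter_upwards [ae_neg hv, ae_neg h.dp_ne_zero, ae_one_sub_ne_zero] with x hx hd h1
  have ht := tpow_ne_zero 1 x
  have hs := tpow_ne_zero m x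
  have h2 : tpow 1 x - 1 ≠ 0 := fun h => h1 (by linear_combination -h)
  simp only [flip, tilde, neg_neg, tpow_neg_arg, hw] at hx ⊢
  generalize thFun a b f x = F at *
  rw [tpow_eq_zpow (-1), zpow_neg, zpow_one] at hx ⊢
  rw [tpow_eq_zpow (-m), zpow_neg, ← tpow_eq_zpow]
  field_simp at hx ⊢
  apply mul_left_cancel₀ h2
  linear_combination hx

/-- The even part of `(1 + t) tⁿ c₊ f` in terms of `ρ`, for `f` a solution of the kernel
equation. -/
lemma ae_even_part (h : BasicFactorization p q a b c d n m cp dp) {f w : Torus → ℂ}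
    (hF : ∀ᵐ x ∂arc, thFun a b f x = (1 + tpow (-1) x) * tpow (-m) x * dp (-x) * w x) :
    ∀ᵐ x ∂arc, tpow n x * (((1 + tpow 1 x) * cp x) * f x) +
        tilde (fun x => tpow n x * (((1 + tpow 1 x) * cp x) * f x)) x =
      rho b n m cp dp x * w x := by
  filter_upwards [h.ae_relations, hF] with x ⟨⟨ha, hb, hb', hcp, hcp', hdp, hdp'⟩, _, ⟨e1, e2⟩⟩ hx
  have ht := tpow_ne_zero 1 x
  have hs := tpow_ne_zero n x
  have hr := tpow_ne_zero m x
  simp only [tilde, flip, thFun, tpow_neg_arg, rho, sub_eq_add_neg, tpow_add] at hx ⊢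
  rw [tpow_eq_zpow (-1), zpow_neg, zpow_one] at hx ⊢
  rw [tpow_eq_zpow (-m), zpow_neg, ← tpow_eq_zpow] at hx ⊢
  rw [tpow_eq_zpow (-n), zpow_neg, ← tpow_eq_zpow]
  field_simp at hx ⊢
  linear_combination (1 + tpow 1 x) * cp (-x) * hx
    - (1 + tpow 1 x) * tpow 1 x * tpow m x * f x * e1

/-- Transposition: the transposed operator `T(ã) + H(b)` on `H^q` has the roles of `c` and `d`
interchanged. -/
lemma transpose (h : BasicFactorization p q a b c d n m cp dp) :
    BasicFactorization q p (reflOp ∞ a) b d c m n dp cp := by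
  have hr : (reflOp ∞ a : Torus → ℂ) =ᵐ[arc] tilde a :=
    Lp.coeFn_compMeasurePreserving a measurePreserving_neg_arc
  have hr' : ∀ᵐ x ∂arc, (reflOp ∞ a : Torus → ℂ) (-x) = a x := by
    filter_upwards [ae_neg hr] with x hx
    simpa [tilde] using hx
  have hb0 := h.ae_b_ne_zero
  exact
  { unit_a := by
      obtain ⟨a', ha⟩ := h.unit_a
      refine ⟨reflOp ∞ a', ?_⟩
      have hr2 : (reflOp ∞ a' : Torus → ℂ) =ᵐ[arc] tilde a' :=
        Lp.coeFn_compMeasurePreserving a' measurePreserving_neg_arc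
      filter_upwards [hr, hr2, ae_neg ha] with x h1 h2 h3
      rw [h1, h2]; exact h3
    unit_b := h.unit_b
    compat := by
      filter_upwards [hr, hr', h.compat] with x h1 h2 h3
      simp only [tilde] at *
      rw [h1, h2, mul_comm]; exact h3
    c_eq := by
      filter_upwards [hr, h.d_eq] with x h1 h2
      rw [h1, h2]
    c_eq' := by
      filter_upwards [hr', h.d_eq'] with x h1 h2
      simp only [tilde] at *
      rw [h1, h2]
    d_eq := by
      filter_upwards [hr', h.c_eq] with x h1 h2
      simp only [tilde] at *
      rw [h1, h2]
    d_eq' := by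
      filter_upwards [hr, h.c_eq'] with x h1 h2
      rw [h1, h2]
    cp_ne_zero := h.dp_ne_zero
    dp_ne_zero := h.cp_ne_zero
    c_factor := h.d_factor
    d_factor := h.c_factor
    cp_mem := h.dp_mem
    cp_inv_mem := h.dp_inv_mem
    dp_mem := h.cp_mem
    dp_inv_mem := h.cp_inv_mem }

lemma ae_mulOp_fourierLp (k : ℤ) (a : LpT ∞) :
    (mulOp ∞ (fourierLp ∞ k) a : Torus → ℂ) =ᵐ[arc] fun x => tpow k x * a x := by
  filter_upwards [(ContinuousLinearMap.mul ℂ ℂ).coeFn_holder (r := ∞) (fourierLp ∞ k) a,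
    coeFn_fourierLp ∞ k] with x hx h2
  simp only [mulOp, ContinuousLinearMap.holderL_apply_apply, hx, ContinuousLinearMap.mul_apply', h2]
  rfl

lemma isUnitLinf_mulOp_fourierLp (k : ℤ) {a : LpT ∞} (ha : IsUnitLinf a) :
    IsUnitLinf (mulOp ∞ (fourierLp ∞ k) a) := by
  obtain ⟨a', ha⟩ := ha
  refine ⟨mulOp ∞ (fourierLp ∞ (-k)) a', ?_⟩
  filter_upwards [ae_mulOp_fourierLp k a, ae_mulOp_fourierLp (-k) a', ha] with x h1 h2 h3
  have := tpow_add k (-k) x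
  rw [add_neg_cancel, tpow_zero] at this
  rw [h1, h2]
  linear_combination tpow k x * tpow (-k) x * h3 - this

/-- Shifting both indices to zero: `t^{m-n} a` and `t^{m+n} b` have the same factors `c₊, d₊`, with
indices `0, 0`. -/
lemma reduce (h : BasicFactorization p q a b c d n m cp dp) :
    BasicFactorization p q (mulOp ∞ (fourierLp ∞ (m - n)) a) (mulOp ∞ (fourierLp ∞ (m + n)) b)
      (mulOp ∞ (fourierLp ∞ (-(2 * n))) c) (mulOp ∞ (fourierLp ∞ (-(2 * m))) d) 0 0 cp dp := by
  have ha := ae_mulOp_fourierLp (m - n) a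
  have hb := ae_mulOp_fourierLp (m + n) b
  have hc := ae_mulOp_fourierLp (-(2 * n)) c
  have hd := ae_mulOp_fourierLp (-(2 * m)) d
  have key : ∀ x : Torus, tpow (m - n) x = tpow m x * (tpow n x)⁻¹ ∧
      tpow (m - n) (-x) = (tpow m x)⁻¹ * tpow n x ∧ tpow (m + n) x = tpow m x * tpow n x ∧
      tpow (m + n) (-x) = (tpow m x)⁻¹ * (tpow n x)⁻¹ ∧
      tpow (-(2 * n)) x = (tpow n x)⁻¹ * (tpow n x)⁻¹ ∧
      tpow (-(2 * m)) x = (tpow m x)⁻¹ * (tpow m x)⁻¹ ∧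
      tpow (2 * n) x = tpow n x * tpow n x ∧ tpow (2 * m) x = tpow m x * tpow m x := fun x => by
    have hneg : ∀ k, tpow (-k) x = (tpow k x)⁻¹ := fun k => by
      rw [tpow_eq_zpow (-k), zpow_neg, ← tpow_eq_zpow]
    simp only [tpow_neg_arg, neg_add, sub_eq_add_neg, two_mul, tpow_add, hneg, and_true, neg_neg]
  exact
  { unit_a := isUnitLinf_mulOp_fourierLp _ h.unit_a
    unit_b := isUnitLinf_mulOp_fourierLp _ h.unit_b
    compat := by
      filter_upwards [ha, hb, ae_neg ha, ae_neg hb, h.compat] with x h1 h2 h3 h4 h5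
      obtain ⟨k1, k2, k3, k4, -⟩ := key x
      have hn := tpow_ne_zero n x
      have hm := tpow_ne_zero m x
      simp only [tilde] at *
      rw [h1, h2, h3, h4, k1, k2, k3, k4]
      field_simp
      exact h5
    c_eq := by
      filter_upwards [ha, hb, hc, h.c_eq, h.ae_b_ne_zero] with x h1 h2 h3 h4 h5
      obtain ⟨k1, -, k3, -, k5, -⟩ := key x
      have hn := tpow_ne_zero n x
      have hm := tpow_ne_zero m x
      rw [h1, h2, h3, h4, k1, k3, k5]
      field_simp
    c_eq' := by
      filter_upwards [ae_neg ha, ae_neg hb, hc, h.c_eq', ae_neg h.ae_a_ne_zero]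
        with x h1 h2 h3 h4 h5
      obtain ⟨-, k2, -, k4, k5, -⟩ := key x
      have hn := tpow_ne_zero n x
      have hm := tpow_ne_zero m x
      simp only [tilde] at *
      rw [h1, h2, h3, h4, k2, k4, k5]
      field_simp
    d_eq := by
      filter_upwards [ae_neg ha, hb, hd, h.d_eq, h.ae_b_ne_zero] with x h1 h2 h3 h4 h5
      obtain ⟨-, k2, k3, -, -, k6, -⟩ := key x
      have hn := tpow_ne_zero n x
      have hm := tpow_ne_zero m x
      simp only [tilde] at *
      rw [h1, h2, h3, h4, k2, k3, k6]
      field_simp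
    d_eq' := by
      filter_upwards [ha, ae_neg hb, hd, h.d_eq', h.ae_a_ne_zero] with x h1 h2 h3 h4 h5
      obtain ⟨k1, -, -, k4, -, k6, -⟩ := key x
      have hn := tpow_ne_zero n x
      have hm := tpow_ne_zero m x
      simp only [tilde] at *
      rw [h1, h2, h3, h4, k1, k4, k6]
      field_simp
    cp_ne_zero := h.cp_ne_zero
    dp_ne_zero := h.dp_ne_zero
    c_factor := by
      filter_upwards [hc, h.c_factor] with x h1 h2
      obtain ⟨-, -, -, -, k5, -, k7, -⟩ := key x
      have hn := tpow_ne_zero n x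
      rw [h1, h2, k5, k7, mul_zero, tpow_zero]
      field_simp
    d_factor := by
      filter_upwards [hd, h.d_factor] with x h1 h2
      obtain ⟨-, -, -, -, -, k6, -, k8⟩ := key x
      have hn := tpow_ne_zero m x
      rw [h1, h2, k6, k8, mul_zero, tpow_zero]
      field_simp
    cp_mem := h.cp_mem
    cp_inv_mem := h.cp_inv_mem
    dp_mem := h.dp_mem
    dp_inv_mem := h.dp_inv_mem }

end BasicFactorization
namespace BasicFactorization

variable {p q : ℝ≥0∞} {a b c d : LpT ∞} {n m : ℤ} {cp dp : Torus → ℂ}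

/-! ### Solutions of the kernel equation -/

/-- If the analytic part of `a f + b J f` vanishes, then `a f + b J f` is determined by an even
Laurent polynomial of degree less than `m`. -/
lemma exists_even_polynomial (h : BasicFactorization p q a b c d n m cp dp)
    [hpq : p.HolderConjugate q] (hmul : HardyMul p q) {f : Torus → ℂ} (hf : MemLp f p arc)
    (hF : ∀ k : ℤ, 0 ≤ k → fourierCoeff (thFun a b f) k = 0) :
    ∃ y : ℕ → ℂ, ∀ᵐ x ∂arc, thFun a b f x = (1 + tpow (-1) x) * tpow (-m) x * dp (-x) *
      ∑ j ∈ Finset.range m.toNat, y j * (tpow j x + tpow (-j) x) := by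
  have hJ : MemHardy p (flip (thFun a b f)) :=
    ⟨memLp_flip (memLp_thFun a b hf), fun k hk => by
      rw [fourierCoeff_flip]; exact hF _ (by omega)⟩
  have hint : Integrable (fun x => tpow (-m) x * (((1 - tpow 1 x) * (dp x)⁻¹) *
      flip (thFun a b f) x)) arc := by
    refine memLp_one_iff_integrable.1 (memLp_bdd_mul (memLp_tpow _ _)
      (memLp_one_iff_integrable.2 ?_))
    simpa only [mul_comm] using integrable_mul_conj hJ.1 h.dp_inv_mem.1
  obtain ⟨y, hy⟩ := exists_even_factor m.toNat hint (h.ae_odd_left f) (fun k hk => by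
    rw [fourierCoeff_tpow_mul]
    exact hmul.symm _ _ h.dp_inv_mem hJ _ (by omega))
  refine ⟨y, h.ae_thFun_eq (w := fun x => ∑ j ∈ Finset.range m.toNat,
    y j * (tpow j x + tpow (-j) x)) (fun x => ?_) hy⟩
  simp only [tpow_neg_arg, neg_neg]
  exact Finset.sum_congr rfl fun j _ => by rw [add_comm (tpow (-(j : ℤ)) x)]

/-- For `m ≤ 0` the kernel equation `P(a f + b J f) = 0` reads `a f + b J f = 0`. -/
lemma ae_thFun_eq_zero (h : BasicFactorization p q a b c d n m cp dp)
    [hpq : p.HolderConjugate q] (hmul : HardyMul p q) (hm : m ≤ 0) {f : Torus → ℂ}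
    (hf : MemLp f p arc) (hF : ∀ k : ℤ, 0 ≤ k → fourierCoeff (thFun a b f) k = 0) :
    thFun a b f =ᵐ[arc] 0 := by
  obtain ⟨y, hy⟩ := h.exists_even_polynomial hmul hf hF
  filter_upwards [hy] with x hx
  rw [hx, Int.toNat_of_nonpos hm]; simp

/-- For `n ≥ 0` and `m ≤ 0`, the operator `T(a) + H(b)` is injective. -/
lemma ae_eq_zero_of_analytic_part (h : BasicFactorization p q a b c d n m cp dp)
    [hpq : p.HolderConjugate q] (hmul : HardyMul p q) (hn : 0 ≤ n) (hm : m ≤ 0) {f : Torus → ℂ}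
    (hf : MemHardy p f) (hF : ∀ k : ℤ, 0 ≤ k → fourierCoeff (thFun a b f) k = 0) :
    f =ᵐ[arc] 0 := by
  have h0 := ae_eq_zero_of_odd (v := fun x => tpow n x * (((1 + tpow 1 x) * cp x) * f x))
    (memLp_one_iff_integrable.1 (memLp_bdd_mul (memLp_tpow _ _)
      (memLp_one_iff_integrable.2 (by
        simpa only [mul_comm] using integrable_mul_conj hf.1 h.cp_mem.1))))
    (h.ae_odd_right (h.ae_thFun_eq_zero hmul hm hf.1 hF)) (fun k hk => by
      rw [fourierCoeff_tpow_mul]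
      exact hmul.symm _ _ h.cp_mem hf _ (by omega))
  filter_upwards [h0, h.cp_ne_zero, ae_one_add_ne_zero] with x hx h1 h2
  simpa [tpow_ne_zero, h1, h2] using hx

lemma integrable_rho (h : BasicFactorization p q a b c d n m cp dp)
    [hpq : p.HolderConjugate q] : Integrable (rho b n m cp dp) arc := by
  obtain ⟨b', hb⟩ := h.unit_b
  have h1 := integrable_mul_conj (memLp_tilde h.dp_mem.1) (memLp_tilde h.cp_mem.1)
  have h2 := memLp_bdd_mul (memLp_tpow (1 - m - n) ∞) (memLp_bdd_mul (Lp.memLp b')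
    (memLp_one_iff_integrable.2 h1))
  refine (memLp_one_iff_integrable.1 h2).congr ?_
  filter_upwards [hb] with x hx
  have hbx : b x ≠ 0 := fun h0 => by simp [h0] at hx
  rw [eq_inv_of_mul_eq_one_right hx]
  simp only [rho, tilde, tpow_neg_arg, sub_eq_add_neg, tpow_add]
  have h1 : tpow 1 x * tpow (-1) x = 1 := by rw [← tpow_add]; exact tpow_zero x
  linear_combination (tpow (-m) x * tpow (-n) x * (b x)⁻¹ * dp (-x) * cp (-x) *
    (1 + tpow (-1) x)) * h1

lemma fourierCoeff_rho_mul (h : BasicFactorization p q a b c d n m cp dp)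
    [hpq : p.HolderConjugate q] (M : ℕ) (y : ℕ → ℂ) (i : ℤ) :
    fourierCoeff (fun x => rho b n m cp dp x *
        ∑ j ∈ Finset.range M, y j * (tpow j x + tpow (-j) x)) i =
      ∑ j ∈ Finset.range M, (fourierCoeff (rho b n m cp dp) (i - j) +
        fourierCoeff (rho b n m cp dp) (i + j)) * y j := by
  have hr : ∀ k : ℤ, Integrable (fun x => tpow k x * rho b n m cp dp x) arc := fun k =>
    memLp_one_iff_integrable.1 (memLp_bdd_mul (memLp_tpow _ _)
      (memLp_one_iff_integrable.2 h.integrable_rho))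
  have e : (fun x => rho b n m cp dp x *
      ∑ j ∈ Finset.range M, y j * (tpow j x + tpow (-j) x)) = fun x =>
      ∑ j ∈ Finset.range M, y j * (tpow j x * rho b n m cp dp x +
        tpow (-j) x * rho b n m cp dp x) := by
    funext x
    rw [Finset.mul_sum]
    exact Finset.sum_congr rfl fun j _ => by ring
  have hr2 : ∀ j : ℕ, Integrable (fun x => tpow j x * rho b n m cp dp x +
      tpow (-j) x * rho b n m cp dp x) arc := fun j => (hr _).add (hr _)
  rw [e, fourierCoeff_sum' _ _ fun j _ => (hr2 j).const_mul _]
  refine Finset.sum_congr rfl fun j _ => ?_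
  rw [fourierCoeff.const_mul, fourierCoeff_add' (hr _) (hr _), fourierCoeff_tpow_mul,
    fourierCoeff_tpow_mul, sub_neg_eq_add]
  ring

/-- The coefficients of the even part of `(1 + t) tⁿ c₊ f` are given by the matrix with
entries `ρ_{i-j} + ρ_{i+j}`. -/
lemma fourierCoeff_even_part (h : BasicFactorization p q a b c d n m cp dp)
    [hpq : p.HolderConjugate q] {f : Torus → ℂ} (hf : MemLp f p arc) {M : ℕ} {y : ℕ → ℂ}
    (hF : ∀ᵐ x ∂arc, thFun a b f x = (1 + tpow (-1) x) * tpow (-m) x * dp (-x) *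
      ∑ j ∈ Finset.range M, y j * (tpow j x + tpow (-j) x)) (i : ℤ) :
    fourierCoeff (fun x => tpow n x * (((1 + tpow 1 x) * cp x) * f x)) i +
      fourierCoeff (fun x => tpow n x * (((1 + tpow 1 x) * cp x) * f x)) (-i) =
      ∑ j ∈ Finset.range M, (fourierCoeff (rho b n m cp dp) (i - j) +
        fourierCoeff (rho b n m cp dp) (i + j)) * y j := by
  have hV : MemLp (fun x => tpow n x * (((1 + tpow 1 x) * cp x) * f x)) 1 arc :=
    memLp_bdd_mul (memLp_tpow _ _) (memLp_one_iff_integrable.2 (by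
        simpa only [mul_comm] using integrable_mul_conj hf h.cp_mem.1))
  rw [← h.fourierCoeff_rho_mul, ← fourierCoeff_tilde,
    ← fourierCoeff_add' (memLp_one_iff_integrable.1 hV)
      (memLp_one_iff_integrable.1 (memLp_tilde hV))]
  exact congrFun (fourierCoeff_congr_ae (h.ae_even_part hF)) i

/-- The constant term of `(1 + t) c₊` is nonzero, because `(1 + t) c₊ · (1 - t) c₊⁻¹ = 1 - t²`. -/
lemma fourierCoeff_cp_ne_zero (h : BasicFactorization p q a b c d n m cp dp) [Fact (1 ≤ p)]
    [hpq : p.HolderConjugate q] (hmul : HardyMul p q) :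
    fourierCoeff (fun x => (1 + tpow 1 x) * cp x) 0 ≠ 0 := by
  have h1 := hmul.fourierCoeff_mul h.cp_inv_mem h.cp_mem 0
  have ht : ∀ k, Integrable (tpow k) arc := fun k => memLp_one_iff_integrable.1 (memLp_tpow k 1)
  have h2 : (fun x => (1 - tpow 1 x) * (cp x)⁻¹ * ((1 + tpow 1 x) * cp x)) =ᵐ[arc]
      fun x => tpow 0 x - tpow 2 x := by
    filter_upwards [h.cp_ne_zero] with x hx
    rw [tpow_zero, show (2 : ℤ) = 1 + 1 from rfl, tpow_add]
    field_simp
    ring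
  rw [fourierCoeff_congr_ae h2, fourierCoeff_sub' (ht _) (ht _), fourierCoeff_tpow,
    fourierCoeff_tpow] at h1
  intro h0
  norm_num [h0] at h1

end BasicFactorization

section

/-! ### Toeplitz plus Hankel operators in terms of Fourier coefficients -/

variable {p : ℝ≥0∞} [Fact (1 ≤ p)]

lemma coeFn_mulOp (a : LpT ∞) (f : LpT p) :
    (mulOp p a f : Torus → ℂ) =ᵐ[arc] fun x => a x * f x := by
  filter_upwards [(ContinuousLinearMap.mul ℂ ℂ).coeFn_holder (r := p) a f] with x hx
  simp only [mulOp, ContinuousLinearMap.holderL_apply_apply, hx, ContinuousLinearMap.mul_apply']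

lemma coeFn_flipOp (f : LpT p) : (flipOp p f : Torus → ℂ) =ᵐ[arc] flip f := by
  have hr : (reflOp p f : Torus → ℂ) =ᵐ[arc] tilde f :=
    Lp.coeFn_compMeasurePreserving f measurePreserving_neg_arc
  filter_upwards [coeFn_mulOp (fourierLp ∞ (-1)) (reflOp p f), hr, coeFn_fourierLp ∞ (-1)]
    with x h1 h2 h3
  simp only [flipOp, ContinuousLinearMap.comp_apply, h1, h2, h3]
  rfl

/-- The operator `L(a) + L(b) J` on `L^p`, whose compression to `H^p` is `T(a) + H(b)`. -/
def thOp (p : ℝ≥0∞) [Fact (1 ≤ p)] (a b : LpT ∞) : LpT p →L[ℂ] LpT p :=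
  mulOp p a + mulOp p b ∘L flipOp p

lemma coeFn_thOp (a b : LpT ∞) (f : LpT p) :
    (thOp p a b f : Torus → ℂ) =ᵐ[arc] thFun a b f := by
  filter_upwards [Lp.coeFn_add (mulOp p a f) (mulOp p b (flipOp p f)), coeFn_mulOp a f,
    coeFn_mulOp b (flipOp p f), coeFn_flipOp f] with x h1 h2 h3 h4
  simp only [thOp, add_apply, ContinuousLinearMap.comp_apply, h1, Pi.add_apply,
    h2, h3, h4, thFun]

lemma toeplitz_add_hankel_apply (a b : LpT ∞) (f : hardySpace p) :
    (((toeplitz p a + hankel p b) f : hardySpace p) : LpT p) =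
      rieszProjection p (thOp p a b f) := by
  change rieszProjection p (mulOp p a f) + rieszProjection p (mulOp p b (flipOp p f)) = _
  rw [← map_add]
  rfl

lemma memHardy_coe (f : hardySpace p) : MemHardy p ((f : LpT p) : Torus → ℂ) :=
  ⟨Lp.memLp _, f.2⟩

lemma MemHardy.toLp_mem {f : Torus → ℂ} (hf : MemHardy p f) : hf.1.toLp f ∈ hardySpace p :=
  fun n hn => by rw [fourierCoeff_congr_ae hf.1.coeFn_toLp]; exact hf.2 n hn

lemma MemHardy.exists_coe {f : Torus → ℂ} (hf : MemHardy p f) :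
    ∃ g : hardySpace p, ((g : LpT p) : Torus → ℂ) =ᵐ[arc] f :=
  ⟨⟨_, hf.toLp_mem⟩, hf.1.coeFn_toLp⟩

/-- Functions in `H^p` are determined by their nonnegative Fourier coefficients. -/
lemma hardySpace_ext {f g : hardySpace p}
    (h : ∀ n : ℕ, fourierCoeff ((f : LpT p) : Torus → ℂ) n =
      fourierCoeff ((g : LpT p) : Torus → ℂ) n) : f = g := by
  refine Subtype.ext (LpT_ext fun n => ?_)
  by_cases hn : 0 ≤ n
  · lift n to ℕ using hn; exact h n
  · rw [f.2 n (by omega), g.2 n (by omega)]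

/-- The `k`-th Fourier coefficient as a linear functional on `H^p`. -/
def coeffH (p : ℝ≥0∞) [Fact (1 ≤ p)] (k : ℤ) : hardySpace p →ₗ[ℂ] ℂ where
  toFun f := fourierCoeff ((f : LpT p) : Torus → ℂ) k
  map_add' f g := by
    rw [Submodule.coe_add, fourierCoeff_congr_ae (Lp.coeFn_add _ _)]
    exact fourierCoeff_add' (integrable_LpT p _) (integrable_LpT p _) k
  map_smul' z f := by
    rw [Submodule.coe_smul, fourierCoeff_congr_ae (Lp.coeFn_smul _ _), fourierCoeff.const_smul]
    rfl

lemma coeffH_of_neg {k : ℤ} (hk : k < 0) (f : hardySpace p) : coeffH p k f = 0 := f.2 k hk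

lemma coeffH_ext {f g : hardySpace p} (h : ∀ n : ℕ, coeffH p n f = coeffH p n g) : f = g :=
  hardySpace_ext h

/-- The monomial `t^j` as an element of `H^p`. -/
def monomialH (p : ℝ≥0∞) [Fact (1 ≤ p)] (j : ℕ) : hardySpace p :=
  ⟨fourierLp p j, fun n hn => by rw [fourierCoeff_fourierLp, if_neg (by omega)]⟩

lemma coeffH_monomialH (k : ℤ) (j : ℕ) :
    coeffH p k (monomialH p j) = if k = j then 1 else 0 :=
  fourierCoeff_fourierLp _ _

/-- The first `N` coefficients of a function in `H^p`. -/
def jetH (p : ℝ≥0∞) [Fact (1 ≤ p)] (N : ℕ) : hardySpace p →ₗ[ℂ] (Fin N → ℂ) :=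
  LinearMap.pi fun i => coeffH p i

/-- The analytic polynomial with given coefficients. -/
def polyH (p : ℝ≥0∞) [Fact (1 ≤ p)] (N : ℕ) : (Fin N → ℂ) →ₗ[ℂ] hardySpace p :=
  Fintype.linearCombination ℂ fun i : Fin N => monomialH p i

lemma coeffH_polyH (k : ℕ) {N : ℕ} (r : Fin N → ℂ) :
    coeffH p k (polyH p N r) = if h : k < N then r ⟨k, h⟩ else 0 := by
  simp only [polyH, Fintype.linearCombination_apply, map_sum, map_smul, coeffH_monomialH,
    smul_eq_mul, Nat.cast_inj, mul_ite, mul_one, mul_zero]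
  split_ifs with h
  · rw [Finset.sum_eq_single ⟨k, h⟩]
    · simp
    · intro b _ hb
      rw [if_neg]
      rintro rfl
      exact hb rfl
    · simp
  · exact Finset.sum_eq_zero fun j _ => by rw [if_neg]; have := j.2; omega

lemma jetH_polyH {N : ℕ} (r : Fin N → ℂ) : jetH p N (polyH p N r) = r := by
  funext i
  change coeffH p i (polyH p N r) = r i
  rw [coeffH_polyH, dif_pos i.2]

lemma not_finiteDimensional_hardySpace : ¬ FiniteDimensional ℂ (hardySpace p) := by
  intro hfin
  have h := LinearMap.finrank_le_finrank_of_injective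
    (f := polyH p (Module.finrank ℂ (hardySpace p) + 1))
    (Function.LeftInverse.injective jetH_polyH)
  simp at h

/-- If the bounded Riesz projection did not exist, the operators in question would vanish, and the
zero operator on an infinite-dimensional space is not Fredholm. -/
lemma exists_rieszProjection_of_isFredholm {a b : LpT ∞}
    (h : (toeplitz p a + hankel p b).IsFredholm) :
    ∃ P : LpT p →L[ℂ] LpT p, IsRieszProjection p P := by
  by_contra hP
  have h0 : toeplitz p a + hankel p b = 0 := by
    ext1 f
    refine Subtype.ext ?_
    rw [toeplitz_add_hankel_apply, rieszProjection, dif_neg hP]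
    rfl
  have hker := h.finite_ker
  rw [h0] at hker
  have : LinearMap.ker ((0 : hardySpace p →L[ℂ] hardySpace p) :
      hardySpace p →ₗ[ℂ] hardySpace p) = ⊤ := by
    ext; simp
  rw [this] at hker
  exact not_finiteDimensional_hardySpace
    (Module.Finite.equiv (Submodule.topEquiv (R := ℂ) (M := hardySpace p)))

lemma coeffH_toeplitz_add_hankel
    (hP : ∃ P : LpT p →L[ℂ] LpT p, IsRieszProjection p P)
    (a b : LpT ∞) (f : hardySpace p) (k : ℕ) :
    coeffH p k ((toeplitz p a + hankel p b) f) = fourierCoeff (thFun a b (f : LpT p)) k := by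
  change fourierCoeff (((toeplitz p a + hankel p b) f : hardySpace p) : LpT p) k = _
  rw [toeplitz_add_hankel_apply, isRieszProjection_rieszProjection p hP, if_pos (by omega),
    fourierCoeff_congr_ae (coeFn_thOp a b _)]

lemma coeffH_toeplitz_fourierLp
    (hP : ∃ P : LpT p →L[ℂ] LpT p, IsRieszProjection p P) (j : ℤ) (f : hardySpace p) (k : ℕ) :
    coeffH p k (toeplitz p (fourierLp ∞ j) f) = coeffH p (k - j) f := by
  change fourierCoeff (rieszProjection p (mulOp p (fourierLp ∞ j) (f : LpT p)) : Torus → ℂ) k = _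
  rw [isRieszProjection_rieszProjection p hP, if_pos (by omega),
    fourierCoeff_congr_ae (coeFn_mulOp _ _)]
  rw [show coeffH p (k - j) f = fourierCoeff ((f : LpT p) : Torus → ℂ) (k - j) from rfl,
    ← fourierCoeff_tpow_mul]
  refine congrFun (fourierCoeff_congr_ae ?_) _
  filter_upwards [coeFn_fourierLp ∞ j] with x hx
  rw [hx]; rfl

lemma isClosed_hardySpace {q : ℝ≥0∞} [hpq : p.HolderConjugate q] :
    IsClosed (hardySpace p : Set (LpT p)) := by
  have hq : Fact (1 ≤ q) := ⟨(ENNReal.HolderConjugate.symm (p := p) (q := q)).one_le⟩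
  have e : (hardySpace p : Set (LpT p)) = ⋂ n : ℤ, ⋂ _ : n < 0,
      {f | ((ContinuousLinearMap.mul ℂ ℂ).lpPairing arc p q).flip (fourierLp q (-n)) f = 0} := by
    ext f
    have : ∀ n : ℤ, ((ContinuousLinearMap.mul ℂ ℂ).lpPairing arc p q).flip (fourierLp q (-n)) f =
        fourierCoeff (f : Torus → ℂ) n := fun n => by
      rw [ContinuousLinearMap.flip_apply, ContinuousLinearMap.lpPairing_eq_integral]
      refine integral_congr_ae ?_
      filter_upwards [coeFn_fourierLp q (-n)] with x hx
      rw [hx, ContinuousLinearMap.mul_apply', mul_comm, smul_eq_mul]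
    simp only [this, Set.mem_iInter, Set.mem_ofPred_eq]
    rfl
  rw [e]
  exact isClosed_iInter fun n => isClosed_iInter fun _ =>
    isClosed_eq (ContinuousLinearMap.continuous _) continuous_const

end

/-! ### The dual of `L^p` of a finite measure -/

section LpDual

variable {α : Type*} [MeasurableSpace α] {μ : Measure α} [IsFiniteMeasure μ] {p : ℝ≥0∞}

/-- The indicator function of a measurable set, as an element of `L^p`; zero for other sets. -/
def indLp (p : ℝ≥0∞) (μ : Measure α) [IsFiniteMeasure μ] (E : Set α) : Lp ℂ p μ :=
  open scoped Classical in
  if h : MeasurableSet E then indicatorConstLp p h (measure_ne_top μ E) 1 else 0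

lemma indLp_of_measurableSet {E : Set α} (h : MeasurableSet E) :
    indLp p μ E = indicatorConstLp p h (measure_ne_top μ E) 1 := dif_pos h

lemma indLp_biUnion {f : ℕ → Set α} (hf : ∀ i, MeasurableSet (f i))
    (hd : Pairwise (Function.onFun Disjoint f)) (s : Finset ℕ) :
    indLp p μ (⋃ i ∈ s, f i) = ∑ i ∈ s, indLp p μ (f i) := by
  classical
  induction s using Finset.induction_on with
  | empty =>
    simp only [Finset.notMem_empty, Set.iUnion_of_empty, Set.iUnion_empty, Finset.sum_empty]
    rw [indLp_of_measurableSet MeasurableSet.empty, indicatorConstLp_empty]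
  | insert a s ha ih =>
    have hm : MeasurableSet (⋃ i ∈ s, f i) := Finset.measurableSet_biUnion s fun i _ => hf i
    have hdis : Disjoint (f a) (⋃ i ∈ s, f i) := by
      simp only [Set.disjoint_iUnion_right]
      intro i hi
      exact hd (fun h => ha (h ▸ hi))
    rw [Finset.sum_insert ha, ← ih, Finset.set_biUnion_insert,
      indLp_of_measurableSet (hf a), indLp_of_measurableSet hm,
      indLp_of_measurableSet ((hf a).union hm)]
    exact indicatorConstLp_disjoint_union (hf a) hm (measure_ne_top _ _) (measure_ne_top _ _) hdis 1

variable [Fact (1 ≤ p)]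

lemma hasSum_indLp (hp : p ≠ ∞) {f : ℕ → Set α} (hf : ∀ i, MeasurableSet (f i))
    (hd : Pairwise (Function.onFun Disjoint f)) :
    HasSum (fun i => indLp p μ (f i)) (indLp p μ (⋃ i, f i)) := by
  have hU : MeasurableSet (⋃ i, f i) := MeasurableSet.iUnion hf
  have hm : ∀ s : Finset ℕ, MeasurableSet (⋃ i ∈ s, f i) := fun s =>
    Finset.measurableSet_biUnion s fun i _ => hf i
  have key : Filter.Tendsto (fun s : Finset ℕ => μ (symmDiff (⋃ i ∈ s, f i) (⋃ i, f i)))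
      Filter.atTop (nhds 0) := by
    have h1 : ∀ s : Finset ℕ, μ (symmDiff (⋃ i ∈ s, f i) (⋃ i, f i)) =
        μ (⋃ i, f i) - ∑ i ∈ s, μ (f i) := fun s => by
      have hsub : (⋃ i ∈ s, f i) ⊆ ⋃ i, f i := Set.iUnion₂_subset_iUnion _ _
      rw [symmDiff_of_le hsub, measure_sdiff hsub (hm s).nullMeasurableSet (measure_ne_top _ _),
        measure_biUnion_finset (fun i _ j _ hij => hd hij) (fun i _ => hf i)]
    simp only [h1]
    have h2 : Filter.Tendsto (fun s : Finset ℕ => ∑ i ∈ s, μ (f i)) Filter.atTop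
        (nhds (μ (⋃ i, f i))) := by
      rw [measure_iUnion hd hf]
      exact ENNReal.summable.hasSum
    have h3 := ENNReal.Tendsto.sub (tendsto_const_nhds (x := μ (⋃ i, f i)) (f := Filter.atTop)) h2
      (Or.inl (measure_ne_top _ _))
    rwa [tsub_self] at h3
  unfold HasSum
  simp only [SummationFilter.unconditional_filter, ← indLp_biUnion hf hd]
  rw [indLp_of_measurableSet hU]
  simp only [fun s => indLp_of_measurableSet (p := p) (μ := μ) (hm s)]
  exact tendsto_indicatorConstLp_set hp key

/-- A continuous real functional on `L^p` is represented by an integrable density on indicator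
functions (Radon–Nikodym). -/
lemma exists_real_density (hp : p ≠ ∞) (Ψ : Lp ℂ p μ →L[ℝ] ℝ) :
    ∃ g : α → ℝ, Measurable g ∧ Integrable g μ ∧
      ∀ E, MeasurableSet E → Ψ (indLp p μ E) = ∫ x in E, g x ∂μ := by
  let ν : SignedMeasure α :=
    { measureOf' := fun E => Ψ (indLp p μ E)
      empty' := by
        rw [indLp_of_measurableSet MeasurableSet.empty, indicatorConstLp_empty, map_zero]
      not_measurable' := fun E hE => by rw [indLp, dif_neg hE, map_zero]
      m_iUnion' := fun f hf hd => (hasSum_indLp hp hf hd).mapL Ψ }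
  have hν : ∀ E, ν E = Ψ (indLp p μ E) := fun E => rfl
  have hac : VectorMeasure.AbsolutelyContinuous ν μ.toENNRealVectorMeasure := by
    refine VectorMeasure.AbsolutelyContinuous.mk fun E hE h0 => ?_
    rw [Measure.toENNRealVectorMeasure_apply_measurable hE] at h0
    rw [hν, indLp_of_measurableSet hE]
    have : indicatorConstLp p hE (measure_ne_top μ E) (1 : ℂ) = 0 := by
      rw [Lp.eq_zero_iff_ae_eq_zero]
      refine indicatorConstLp_coeFn.trans ?_
      have : ∀ᵐ x ∂μ, x ∉ E := measure_eq_zero_iff_ae_notMem.1 h0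
      filter_upwards [this] with x hx
      simp [hx]
    rw [this, map_zero]
  refine ⟨ν.rnDeriv μ, SignedMeasure.measurable_rnDeriv _ _, SignedMeasure.integrable_rnDeriv _ _,
    fun E hE => ?_⟩
  rw [← hν, ← withDensityᵥ_apply (SignedMeasure.integrable_rnDeriv _ _) hE,
    SignedMeasure.withDensityᵥ_rnDeriv_eq ν μ hac]

lemma exists_density (hp : p ≠ ∞) (Φ : Lp ℂ p μ →L[ℂ] ℂ) :
    ∃ g : α → ℂ, Measurable g ∧ Integrable g μ ∧
      ∀ E, MeasurableSet E → Φ (indLp p μ E) = ∫ x in E, g x ∂μ := by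
  obtain ⟨u, hum, hu, hu'⟩ := exists_real_density hp
    (Complex.reCLM ∘L Φ.restrictScalars ℝ)
  obtain ⟨v, hvm, hv, hv'⟩ := exists_real_density hp
    (Complex.imCLM ∘L Φ.restrictScalars ℝ)
  refine ⟨fun x => (u x : ℂ) + (v x : ℂ) * Complex.I,
    (Complex.measurable_ofReal.comp hum).add ((Complex.measurable_ofReal.comp hvm).mul_const _),
    hu.ofReal.add (hv.ofReal.mul_const _), fun E hE => ?_⟩
  have h1 := hu' E hE
  have h2 := hv' E hE
  simp only [ContinuousLinearMap.comp_apply, ContinuousLinearMap.coe_restrictScalars',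
    Complex.reCLM_apply, Complex.imCLM_apply] at h1 h2
  have e : ∫ x in E, ((u x : ℂ) + (v x : ℂ) * Complex.I) ∂μ =
      (∫ x in E, (u x : ℂ) ∂μ) + (∫ x in E, (v x : ℂ) ∂μ) * Complex.I := by
    rw [← integral_mul_const]
    exact integral_add hu.ofReal.integrableOn.integrable
      (hv.ofReal.mul_const Complex.I).integrableOn.integrable
  rw [e, integral_complex_ofReal, integral_complex_ofReal, ← h1, ← h2, Complex.re_add_im]

/-- The representation by the density extends to simple functions and, by dominated convergence,
to bounded functions. -/
lemma apply_eq_integral_of_bounded (hp : p ≠ ∞) (Φ : Lp ℂ p μ →L[ℂ] ℂ) {g : α → ℂ}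
    (hg : Integrable g μ)
    (hE : ∀ E, MeasurableSet E → Φ (indLp p μ E) = ∫ x in E, g x ∂μ)
    {f : α → ℂ} (hfm : Measurable f) {C : ℝ} (hC : ∀ x, ‖f x‖ ≤ C)
    (hf : MemLp f p μ) : Φ (hf.toLp f) = ∫ x, f x * g x ∂μ := by
  have hsimple : ∀ (s : SimpleFunc α ℂ) (hs : MemLp s p μ), Φ (hs.toLp s) = ∫ x, s x * g x ∂μ := by
    intro s
    have hbdd : ∀ s : SimpleFunc α ℂ, Integrable (fun x => s x * g x) μ := fun s => by
      obtain ⟨D, hD⟩ := s.exists_forall_norm_le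
      exact hg.bdd_mul (c := D) s.aestronglyMeasurable (ae_of_all _ hD)
    induction s using SimpleFunc.induction with
    | @const z E hs =>
      intro h
      have e : h.toLp _ = z • indLp p μ E := by
        rw [indLp_of_measurableSet hs]
        refine Lp.ext ?_
        filter_upwards [h.coeFn_toLp, 
          Lp.coeFn_smul z (indicatorConstLp p hs (measure_ne_top μ E) (1 : ℂ)),
          indicatorConstLp_coeFn (p := p) (hs := hs) (hμs := measure_ne_top μ E) (c := (1 : ℂ))]
          with x h1 h2 h3
        rw [h1, h2, Pi.smul_apply, h3]
        by_cases hx : x ∈ E <;> simp [hx]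
      rw [e, map_smul, hE E hs, ← integral_indicator hs, smul_eq_mul, ← integral_const_mul]
      refine integral_congr_ae (ae_of_all _ fun x => ?_)
      by_cases hx : x ∈ E <;> simp [hx]
    | @add s₁ s₂ hd h1 h2 =>
      intro h
      have hm1 := s₁.memLp_of_isFiniteMeasure p μ
      have hm2 := s₂.memLp_of_isFiniteMeasure p μ
      have e : h.toLp _ = hm1.toLp s₁ + hm2.toLp s₂ := by
        rw [← MemLp.toLp_add]
        rfl
      rw [e, map_add, h1 hm1, h2 hm2, ← integral_add (hbdd _) (hbdd _)]
      refine integral_congr_ae (ae_of_all _ fun x => ?_)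
      simp [add_mul]
  let s : ℕ → SimpleFunc α ℂ := SimpleFunc.approxOn f hfm Set.univ 0 trivial
  have hs : ∀ n, MemLp (s n) p μ := fun n => (s n).memLp_of_isFiniteMeasure p μ
  have hlim : ∀ x, Filter.Tendsto (fun n => s n x) Filter.atTop (nhds (f x)) :=
    fun x => SimpleFunc.tendsto_approxOn hfm _ (by simp)
  have hb : ∀ n x, ‖s n x‖ ≤ C + C := fun n x =>
    (SimpleFunc.norm_approxOn_zero_le hfm _ x n).trans (add_le_add (hC x) (hC x))
  have t1 : Filter.Tendsto (fun n => Φ ((hs n).toLp _)) Filter.atTop (nhds (Φ (hf.toLp f))) := by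
    refine (Φ.continuous.tendsto _).comp ?_
    rw [Lp.tendsto_Lp_iff_tendsto_eLpNorm'']
    exact SimpleFunc.tendsto_approxOn_Lp_eLpNorm hfm _ hp (by simp) (by simpa using hf.2)
  have t2 : Filter.Tendsto (fun n => ∫ x, s n x * g x ∂μ) Filter.atTop
      (nhds (∫ x, f x * g x ∂μ)) := by
    refine tendsto_integral_of_dominated_convergence (fun x => (C + C) * ‖g x‖)
      (fun n => (s n).aestronglyMeasurable.mul hg.1) (hg.norm.const_mul (C + C))
      (fun n => ae_of_all _ fun x => ?_) (ae_of_all _ fun x => (hlim x).mul_const _)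
    rw [norm_mul]
    exact mul_le_mul_of_nonneg_right (hb n x) (norm_nonneg _)
  exact tendsto_nhds_unique t1 (t2.congr fun n => (hsimple _ (hs n)).symm)

/-- The density of a bounded functional on `L^p` belongs to `L^q`: test the functional on the
truncations of `|g|^{q-2} ḡ`, for which Hölder's inequality is an equality. -/
lemma memLp_density {q : ℝ≥0∞} [hpq : p.HolderConjugate q] (hp1 : 1 < p) (hp : p ≠ ∞)
    (Φ : Lp ℂ p μ →L[ℂ] ℂ) {g : α → ℂ} (hgm : Measurable g) (hg : Integrable g μ)
    (hE : ∀ E, MeasurableSet E → Φ (indLp p μ E) = ∫ x in E, g x ∂μ) : MemLp g q μ := by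
  have hq_top : q ≠ ∞ := (ENNReal.HolderConjugate.lt_top_iff_one_lt q p).2 hp1 |>.ne
  have hq1 : 1 < q := (ENNReal.HolderConjugate.lt_top_iff_one_lt p q).1 hp.lt_top
  set P := p.toReal with hPdef
  set Q := q.toReal with hQdef
  have hPQ : P.HolderConjugate Q := ENNReal.HolderConjugate.toReal_of_ne_top hp hq_top
  have hQ0 : 0 < Q := hPQ.symm.pos
  have hP0 : 0 < P := hPQ.pos
  -- `φ N` is `|g|^{q-2} ḡ` truncated to `|g| ≤ N`, so that `φ N · g = |φ N|^p = |g|^q` there.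
  let S : ℕ → Set α := fun N => {x | ‖g x‖ ≤ N}
  have hS : ∀ N, MeasurableSet (S N) := fun N => measurableSet_le hgm.norm measurable_const
  let φ : ℕ → α → ℂ := fun N => (S N).indicator fun x =>
    (starRingEnd ℂ) (g x) * ((‖g x‖ ^ (Q - 2) : ℝ) : ℂ)
  have hφm : ∀ N, Measurable (φ N) := fun N =>
    ((Complex.continuous_conj.measurable.comp hgm).mul
      (Complex.measurable_ofReal.comp (hgm.norm.pow_const _))).indicator (hS N)
  have hnorm : ∀ z : ℂ, ‖(starRingEnd ℂ) z * ((‖z‖ ^ (Q - 2) : ℝ) : ℂ)‖ = ‖z‖ ^ (Q - 1) := by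
    intro z
    rw [norm_mul, RCLike.norm_conj, Complex.norm_real, Real.norm_of_nonneg (by positivity)]
    rcases eq_or_ne z 0 with rfl | hz
    · rw [norm_zero, zero_mul, Real.zero_rpow]
      exact (sub_pos.2 hPQ.symm.lt).ne'
    · rw [← Real.rpow_one_add' (norm_nonneg z)]
      · congr 1; ring
      · have := hPQ.symm.lt; intro h; linarith
  have hφb : ∀ N x, ‖φ N x‖ ≤ (N : ℝ) ^ (Q - 1) := fun N x => by
    by_cases hx : x ∈ S N
    · simp only [φ, Set.indicator_of_mem hx, hnorm]
      exact Real.rpow_le_rpow (norm_nonneg _) hx (sub_pos.2 hPQ.symm.lt).le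
    · simp only [φ, Set.indicator_of_notMem hx, norm_zero]; positivity
  have hφL : ∀ N, MemLp (φ N) p μ := fun N =>
    MemLp.of_bound (hφm N).aestronglyMeasurable _ (ae_of_all _ (hφb N))
  let I : ℕ → ℝ := fun N => ∫ x in S N, ‖g x‖ ^ Q ∂μ
  have hI0 : ∀ N, 0 ≤ I N := fun N => integral_nonneg fun x => by positivity
  have hΦ : ∀ N, Φ ((hφL N).toLp _) = (I N : ℂ) := fun N => by
    rw [apply_eq_integral_of_bounded hp Φ hg hE (hφm N) (hφb N)]
    simp only [I]
    rw [← integral_complex_ofReal, ← integral_indicator (hS N)]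
    refine integral_congr_ae (ae_of_all _ fun x => ?_)
    by_cases hx : x ∈ S N
    · simp only [φ, Set.indicator_of_mem hx]
      rw [mul_right_comm, Complex.conj_mul', ← Complex.ofReal_pow, ← Complex.ofReal_mul]
      congr 1
      rw [← Real.rpow_natCast, ← Real.rpow_add' (norm_nonneg _)]
      · congr 1; push_cast; ring
      · push_cast; linarith
    · simp [φ, hx]
  have hφn : ∀ N, ‖(hφL N).toLp (φ N)‖ = I N ^ (1 / P) := fun N => by
    rw [Lp.norm_toLp, (hφL N).eLpNorm_eq_integral_rpow_norm (zero_lt_one.trans hp1).ne' hp,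
      ENNReal.toReal_ofReal (by positivity), one_div]
    congr 1
    simp only [I]
    rw [← integral_indicator (hS N)]
    refine integral_congr_ae (ae_of_all _ fun x => ?_)
    by_cases hx : x ∈ S N
    · simp only [φ, Set.indicator_of_mem hx, hnorm]
      rw [← Real.rpow_mul (norm_nonneg _), hPQ.symm.sub_one_mul_conj]
    · simp only [φ, Set.indicator_of_notMem hx, norm_zero]
      exact Real.zero_rpow hP0.ne'
  have hIle : ∀ N, I N ≤ ‖Φ‖ ^ Q := fun N => by
    have h1 := Φ.le_opNorm ((hφL N).toLp _)
    rw [hΦ, hφn, Complex.norm_real, Real.norm_of_nonneg (hI0 N)] at h1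
    rcases (hI0 N).eq_or_lt with h0 | h0
    · rw [← h0]; positivity
    · have h2 : I N ^ (1 / Q) ≤ ‖Φ‖ := by
        have h3 : I N = I N ^ (1 / Q) * I N ^ (1 / P) := by
          rw [← Real.rpow_add h0]
          have := hPQ.inv_add_inv_eq_one
          rw [show 1 / Q + 1 / P = 1 by rw [one_div, one_div, add_comm]; exact this, Real.rpow_one]
        have h4 : 0 < I N ^ (1 / P) := Real.rpow_pos_of_pos h0 _
        rw [h3] at h1
        have := le_of_mul_le_mul_right (a := I N ^ (1 / P)) (b := I N ^ (1 / Q)) (c := ‖Φ‖) ?_ h4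
        · exact this
        · rwa [← h3] at h1 ⊢
      calc I N = (I N ^ (1 / Q)) ^ Q := by
            rw [← Real.rpow_mul h0.le, one_div_mul_cancel hQ0.ne', Real.rpow_one]
        _ ≤ ‖Φ‖ ^ Q := Real.rpow_le_rpow (by positivity) h2 hQ0.le
  refine ⟨hg.1, ?_⟩
  rw [eLpNorm_lt_top_iff_lintegral_rpow_enorm_lt_top (zero_lt_one.trans hq1).ne' hq_top]
  have hmono : Monotone S := fun N M hNM x hx =>
    le_trans (show ‖g x‖ ≤ N from hx) (by exact_mod_cast hNM)
  have hU : ⋃ N, S N = Set.univ := Set.eq_univ_of_forall fun x =>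
    Set.mem_iUnion.2 (exists_nat_ge ‖g x‖)
  have hsup := hmono.measure_iUnion (μ := μ.withDensity fun x => ‖g x‖ₑ ^ Q)
  rw [hU, withDensity_apply _ MeasurableSet.univ, setLIntegral_univ] at hsup
  rw [hsup]
  refine lt_of_le_of_lt (iSup_le fun N => ?_) (ENNReal.ofReal_lt_top (r := ‖Φ‖ ^ Q))
  rw [withDensity_apply _ (hS N)]
  refine le_trans (le_of_eq ?_) (ENNReal.ofReal_le_ofReal (hIle N))
  have hint : Integrable (fun x => ‖g x‖ ^ Q) (μ.restrict (S N)) := by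
    refine Integrable.of_bound (hgm.norm.pow_const _).aestronglyMeasurable ((N : ℝ) ^ Q) ?_
    refine (ae_restrict_iff' (hS N)).2 (ae_of_all _ fun x hx => ?_)
    rw [Real.norm_of_nonneg (by positivity)]
    exact Real.rpow_le_rpow (norm_nonneg _) hx hQ0.le
  rw [ofReal_integral_eq_lintegral_ofReal hint (ae_of_all _ fun x => by positivity)]
  refine lintegral_congr fun x => ?_
  rw [← ofReal_norm, ENNReal.ofReal_rpow_of_nonneg (norm_nonneg _) hQ0.le]

/-- Every continuous linear functional on `L^p` of a finite measure, `1 < p < ∞`, is integration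
against a function of `L^q`. -/
theorem exists_memLp_forall_apply_eq_integral {q : ℝ≥0∞} [hpq : p.HolderConjugate q] (hp1 : 1 < p)
    (hp : p ≠ ∞) (Φ : Lp ℂ p μ →L[ℂ] ℂ) :
    ∃ g : α → ℂ, MemLp g q μ ∧ ∀ f : Lp ℂ p μ, Φ f = ∫ x, f x * g x ∂μ := by
  obtain ⟨g, hgm, hg, hE⟩ := exists_density hp Φ
  have hgq : MemLp g q μ := memLp_density hp1 hp Φ hgm hg hE
  have hq : Fact (1 ≤ q) := ⟨(ENNReal.HolderConjugate.symm (p := p) (q := q)).one_le⟩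
  let Λ : Lp ℂ p μ →L[ℂ] ℂ := ((ContinuousLinearMap.mul ℂ ℂ).lpPairing μ p q).flip (hgq.toLp g)
  have hΛ : ∀ f : Lp ℂ p μ, Λ f = ∫ x, f x * g x ∂μ := fun f => by
    simp only [Λ, ContinuousLinearMap.flip_apply, ContinuousLinearMap.lpPairing_eq_integral,
      ContinuousLinearMap.mul_apply']
    refine integral_congr_ae ?_
    filter_upwards [hgq.coeFn_toLp] with x hx
    rw [hx]
  refine ⟨g, hgq, fun f => ?_⟩
  rw [← hΛ]
  refine Lp.induction hp (motive := fun f => Φ f = Λ f) (fun z E hs hμs => ?_)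
    (fun f g hf hg _ h1 h2 => ?_) (isClosed_eq Φ.continuous Λ.continuous) f
  · have e : (Lp.simpleFunc.indicatorConst p hs hμs.ne z : Lp ℂ p μ) = z • indLp p μ E := by
      rw [indLp_of_measurableSet hs, Lp.simpleFunc.coe_indicatorConst]
      refine Lp.ext ?_
      filter_upwards [indicatorConstLp_coeFn (p := p) (hs := hs) (hμs := hμs.ne) (c := z),
        Lp.coeFn_smul z (indicatorConstLp p hs (measure_ne_top μ E) (1 : ℂ)),
        indicatorConstLp_coeFn (p := p) (hs := hs) (hμs := measure_ne_top μ E) (c := (1 : ℂ))]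
        with x h1 h2 h3
      rw [h1, h2, Pi.smul_apply, h3]
      by_cases hx : x ∈ E <;> simp [hx]
    rw [e, map_smul, map_smul, hE E hs, hΛ, ← integral_indicator hs]
    congr 1
    refine integral_congr_ae ?_
    rw [indLp_of_measurableSet hs]
    filter_upwards [indicatorConstLp_coeFn (p := p) (hs := hs) (hμs := measure_ne_top μ E)
      (c := (1 : ℂ))] with x h3
    rw [h3]
    by_cases hx : x ∈ E <;> simp [hx]
  · rw [map_add, map_add, h1, h2]

end LpDual

/-! ### Invertibility for vanishing indices -/

/-- Transposition of `L(a) + L(b) J` with respect to the bilinear pairing `∫ f(t) g(t⁻¹)`. -/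
lemma integral_thFun_mul_tilde {p q : ℝ≥0∞} [hpq : p.HolderConjugate q] (a b : LpT ∞)
    {f g : Torus → ℂ} (hf : MemLp f p arc) (hg : MemLp g q arc) :
    ∫ x, thFun a b f x * tilde g x ∂arc = ∫ x, thFun (reflOp ∞ a) b g x * tilde f x ∂arc := by
  have hr : (reflOp ∞ a : Torus → ℂ) =ᵐ[arc] tilde a :=
    Lp.coeFn_compMeasurePreserving a measurePreserving_neg_arc
  have hA : Integrable (fun x => a x * f x * tilde g x) arc :=
    integrable_mul_conj (memLp_bdd_mul (Lp.memLp a) hf) (memLp_tilde hg)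
  have hB : Integrable (fun x => b x * flip f x * tilde g x) arc :=
    integrable_mul_conj (memLp_bdd_mul (Lp.memLp b) (memLp_flip hf)) (memLp_tilde hg)
  have hA' : Integrable (fun x => a (-x) * f (-x) * g x) arc := by
    have := measurePreserving_neg_arc.integrable_comp_of_integrable hA
    simpa [Function.comp_def, tilde] using this
  calc ∫ x, thFun a b f x * tilde g x ∂arc
      = ∫ x, (a x * f x * tilde g x + b x * flip f x * tilde g x) ∂arc := by
        simp only [thFun, add_mul]
    _ = ∫ x, a x * f x * tilde g x ∂arc + ∫ x, b x * flip f x * tilde g x ∂arc :=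
        integral_add hA hB
    _ = ∫ x, a (-x) * f (-x) * g x ∂arc + ∫ x, b x * flip f x * tilde g x ∂arc := by
        congr 1
        rw [← measurePreserving_neg_arc.integral_comp' (f := MeasurableEquiv.neg Torus)]
        simp [tilde]
    _ = ∫ x, (a (-x) * f (-x) * g x + b x * flip f x * tilde g x) ∂arc :=
        (integral_add hA' hB).symm
    _ = ∫ x, thFun (reflOp ∞ a) b g x * tilde f x ∂arc := by
        refine integral_congr_ae ?_
        filter_upwards [hr] with x hx
        simp only [thFun, hx, tilde, flip]
        ring

namespace BasicFactorization

variable {p q : ℝ≥0∞} [Fact (1 ≤ p)] {a b c d : LpT ∞} {n m : ℤ} {cp dp : Torus → ℂ}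

lemma injective_of_index_zero (h : BasicFactorization p q a b c d 0 0 cp dp)
    [hpq : p.HolderConjugate q] (hp_top : p ≠ ∞)
    (hP : ∃ P : LpT p →L[ℂ] LpT p, IsRieszProjection p P) :
    Function.Injective (toeplitz p a + hankel p b) := by
  rw [injective_iff_map_eq_zero]
  intro f hf
  have hmul : HardyMul p q := hardyMul_of_rieszProjection hp_top hP
  have h0 := h.ae_eq_zero_of_analytic_part hmul le_rfl le_rfl (memHardy_coe f) fun k hk => by
    lift k to ℕ using hk
    rw [← coeffH_toeplitz_add_hankel hP, hf, map_zero]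
  exact Subtype.ext (Lp.ext (h0.trans (Lp.coeFn_zero ℂ p arc).symm))

/-- A functional annihilating the range of `T(a) + H(b)` is given by a function `g ∈ H^q` in the
kernel of the transposed operator `T(ã) + H(b)`, which is again an operator with vanishing
indices; so `g = 0`. -/
lemma eq_zero_of_annihilates_range (h : BasicFactorization p q a b c d 0 0 cp dp)
    [hpq : p.HolderConjugate q] (hp_one : 1 < p) (hp_top : p ≠ ∞)
    (hP : ∃ P : LpT p →L[ℂ] LpT p, IsRieszProjection p P) (φ : hardySpace p →L[ℂ] ℂ)
    (hφ : ∀ f, φ ((toeplitz p a + hankel p b) f) = 0) : φ = 0 := by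
  have hmul : HardyMul p q := hardyMul_of_rieszProjection hp_top hP
  have hRP := isRieszProjection_rieszProjection p hP
  let Φ : LpT p →L[ℂ] ℂ := φ ∘L
    (rieszProjection p).codRestrict (hardySpace p) (rieszProjection_mem p)
  obtain ⟨g, hg, hΦ⟩ := exists_memLp_forall_apply_eq_integral (q := q) hp_one hp_top Φ
  have hPH : ∀ f : hardySpace p, rieszProjection p (f : LpT p) = f := fun f => LpT_ext fun n => by
    rw [hRP]
    split_ifs with hn
    · rfl
    · exact (f.2 n (by omega)).symm
  have hΦH : ∀ f : hardySpace p, Φ f = φ f := fun f => by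
    simp only [Φ, ContinuousLinearMap.comp_apply]
    congr 1
    exact Subtype.ext (hPH f)
  -- `Φ` kills the negative powers of `t`, so that `g̃` lies in `H^q`.
  have hG : MemHardy q (tilde g) := by
    refine ⟨memLp_tilde hg, fun n hn => ?_⟩
    have h1 : Φ (fourierLp p n) = 0 := by
      have : (rieszProjection p).codRestrict (hardySpace p) (rieszProjection_mem p)
          (fourierLp p n) = 0 := by
        refine Subtype.ext (LpT_ext fun k => ?_)
        change fourierCoeff (rieszProjection p (fourierLp p n) : Torus → ℂ) k =
          fourierCoeff ((0 : LpT p) : Torus → ℂ) k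
        rw [hRP, fourierCoeff_fourierLp, fourierCoeff_congr_ae (Lp.coeFn_zero ℂ p arc)]
        have : fourierCoeff (0 : Torus → ℂ) k = 0 := by simp [fourierCoeff]
        rw [this]
        split_ifs <;> first | rfl | omega
      simp only [Φ, ContinuousLinearMap.comp_apply, this, map_zero]
    rw [hΦ] at h1
    rw [fourierCoeff_tilde, ← h1]
    refine integral_congr_ae ?_
    filter_upwards [coeFn_fourierLp p n] with x hx
    rw [hx, neg_neg, smul_eq_mul]
  -- Pairing with the range of the operator: `g̃` is in the kernel of the transpose.
  have hdual : ∀ k : ℤ, 0 ≤ k → fourierCoeff (thFun (reflOp ∞ a) b (tilde g)) k = 0 := by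
    intro k hk
    lift k to ℕ using hk
    have h1 : Φ (thOp p a b (monomialH p k)) = 0 := by
      rw [← hφ (monomialH p k)]
      simp only [Φ, ContinuousLinearMap.comp_apply]
      congr 1
      exact Subtype.ext (toeplitz_add_hankel_apply a b _).symm
    rw [hΦ] at h1
    have h2 := integral_thFun_mul_tilde (p := p) (q := q) a b (f := tpow k) (memLp_tpow k p) hG.1
    rw [tilde_tilde] at h2
    have h3 : ∫ x, (thOp p a b (monomialH p k) : Torus → ℂ) x * g x ∂arc =
        ∫ x, thFun a b (tpow k) x * g x ∂arc := by
      have e1 : ((monomialH p k : LpT p) : Torus → ℂ) =ᵐ[arc] tpow k := coeFn_fourierLp p k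
      refine integral_congr_ae ?_
      filter_upwards [coeFn_thOp a b (monomialH p k : LpT p), e1, ae_neg e1] with x hx h4 h5
      rw [hx]
      simp only [thFun, flip, tilde, h4, h5]
    rw [← h3, h1] at h2
    rw [h2]
    refine integral_congr_ae (ae_of_all _ fun x => ?_)
    simp only [smul_eq_mul, tilde, tpow_neg_arg]
    exact mul_comm _ _
  have : q.HolderConjugate p := ENNReal.HolderConjugate.symm
  have hg0 := h.transpose.ae_eq_zero_of_analytic_part hmul.symm le_rfl le_rfl hG hdual
  have hΦ0 : ∀ f, Φ f = 0 := fun f => by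
    rw [hΦ]
    refine integral_eq_zero_of_ae ?_
    filter_upwards [ae_neg hg0] with x hx
    simp only [tilde, neg_neg] at hx
    rw [hx]; simp
  ext f
  rw [← hΦH, hΦ0]; rfl

lemma bijective_of_index_zero (h : BasicFactorization p q a b c d 0 0 cp dp)
    [hpq : p.HolderConjugate q] (hp_one : 1 < p) (hp_top : p ≠ ∞)
    (hP : ∃ P : LpT p →L[ℂ] LpT p, IsRieszProjection p P)
    (hfin : (toeplitz p a + hankel p b).range.CoFG) :
    Function.Bijective (toeplitz p a + hankel p b) := by
  have hinj := h.injective_of_index_zero hp_top hP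
  refine ⟨hinj, ?_⟩
  have : CompleteSpace (hardySpace p) := (isClosed_hardySpace (q := q)).completeSpace_coe
  obtain ⟨G, hG⟩ := Submodule.exists_isCompl (toeplitz p a + hankel p b).range
  have hGfin : FiniteDimensional ℂ G := Module.Finite.iff_fg.2 (hfin.fg_of_isCompl hG)
  have hclosed := (toeplitz p a + hankel p b).closed_complemented_range_of_isCompl_of_ker_eq_bot
    G hG G.closed_of_finiteDimensional (LinearMap.ker_eq_bot.2 hinj)
  by_contra hsurj
  have hsurj' : ∃ y, y ∉ (toeplitz p a + hankel p b).range := by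
    by_contra hcon
    push Not at hcon
    exact hsurj hcon
  obtain ⟨y, hy⟩ := hsurj'
  set Y : Submodule ℂ (hardySpace p) := (toeplitz p a + hankel p b).range with hY
  have hclosed' : IsClosed (Y : Set (hardySpace p)) := hclosed
  have hne : Y.mkQ y ≠ 0 := by simpa using hy
  obtain ⟨ψ, hψ⟩ := SeparatingDual.exists_ne_zero (R := ℂ) hne
  have hφ := h.eq_zero_of_annihilates_range hp_one hp_top hP (ψ ∘L Y.mkQL) fun f => by
    have : Y.mkQL ((toeplitz p a + hankel p b) f) = 0 :=
      (Submodule.Quotient.mk_eq_zero Y).2 ⟨f, rfl⟩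
    rw [ContinuousLinearMap.comp_apply, this, map_zero]
  exact hψ (DFunLike.congr_fun hφ y)

end BasicFactorization

/-! ### Reduction to a finite matrix -/

/-- Let `0 → H → H → W → 0` (maps `τ`, `jet`) and `0 → V → H → H → 0` (maps `pol`, `σ`) be exact.
Then `σ M τ` is bijective exactly when the compression of `M⁻¹` to a map `V → W` is. -/
lemma bijective_comp_iff {K H V W : Type*} [Field K] [AddCommGroup H] [Module K H] [AddCommGroup V]
    [Module K V] [AddCommGroup W] [Module K W] (M : H ≃ₗ[K] H) (τ σ : H →ₗ[K] H) (jet : H →ₗ[K] W)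
    (pol : V →ₗ[K] H) (hτ : Function.Injective τ) (hτjet : ∀ f, jet f = 0 ↔ ∃ g, τ g = f)
    (hjet : Function.Surjective jet) (hσ : Function.Surjective σ)
    (hσpol : ∀ y, σ y = 0 ↔ ∃ r, pol r = y) (hpol : Function.Injective pol) :
    Function.Bijective (fun f => σ (M (τ f))) ↔
      Function.Bijective (jet ∘ₗ M.symm.toLinearMap ∘ₗ pol) := by
  have hjτ : ∀ f, jet (τ f) = 0 := fun f => (hτjet _).2 ⟨f, rfl⟩
  have hσp : ∀ r, σ (pol r) = 0 := fun r => (hσpol _).2 ⟨r, rfl⟩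
  have hB : ∀ r, (jet ∘ₗ M.symm.toLinearMap ∘ₗ pol) r = jet (M.symm (pol r)) := fun r => rfl
  have hinjM : Function.Injective (fun f => σ (M (τ f))) ↔ ∀ f, σ (M (τ f)) = 0 → f = 0 :=
    injective_iff_map_eq_zero (σ ∘ₗ M.toLinearMap ∘ₗ τ)
  constructor
  · rintro ⟨hinj, hsurj⟩
    constructor
    · rw [injective_iff_map_eq_zero]
      intro r hr
      obtain ⟨g, hg⟩ := (hτjet _).1 hr
      have hMg : M (τ g) = pol r := by
        rw [hg]; exact M.apply_symm_apply _
      have hg0 : g = 0 := hinjM.1 hinj g (by rw [hMg, hσp])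
      rw [hg0, map_zero, map_zero] at hMg
      exact hpol (by rw [← hMg, map_zero])
    · intro z
      obtain ⟨F, hF⟩ := hjet z
      obtain ⟨f, hf⟩ := hsurj (σ (M F))
      obtain ⟨r, hr⟩ := (hσpol (M F - M (τ f))).1 (by
        rw [map_sub, sub_eq_zero]; exact hf.symm)
      refine ⟨r, ?_⟩
      rw [hB, hr, ← map_sub, M.symm_apply_apply, map_sub, hjτ, hF, sub_zero]
  · rintro ⟨hinj, hsurj⟩
    constructor
    · rw [hinjM]
      intro f hf
      obtain ⟨r, hr⟩ := (hσpol _).1 hf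
      have hr0 : r = 0 := (injective_iff_map_eq_zero _).1 hinj r (by
        rw [hB, hr, M.symm_apply_apply, hjτ])
      rw [hr0, map_zero] at hr
      apply hτ
      rw [map_zero]
      exact M.injective (by rw [← hr, map_zero])
    · intro y
      obtain ⟨u, rfl⟩ := hσ y
      obtain ⟨r, hr⟩ := hsurj (-jet (M.symm u))
      rw [hB] at hr
      obtain ⟨f, hf⟩ := (hτjet (M.symm (u + pol r))).1 (by
        rw [map_add, map_add, hr, add_neg_cancel])
      refine ⟨f, ?_⟩
      change σ (M (τ f)) = σ u
      rw [hf, M.apply_symm_apply, map_add, hσp, add_zero]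

/-- If `σ T` has a range of finite codimension and `σ` has a finite-dimensional kernel then the
range of `T` has finite codimension. -/
lemma cofg_range_of_comp {K H V : Type*} [Field K] [AddCommGroup H] [Module K H] [AddCommGroup V]
    [Module K V] [FiniteDimensional K V] (T σ M : H →ₗ[K] H) (pol : V →ₗ[K] H)
    (hσpol : ∀ y, σ y = 0 → ∃ r, pol r = y) (hM : ∀ f, ∃ g, M f = σ (T g)) (hfin : M.range.CoFG) :
    T.range.CoFG := by
  have hfin' : (LinearMap.range M).CoFG := hfin
  have h1 : (LinearMap.ker (M.range.mkQ ∘ₗ σ)).CoFG := Submodule.CoFG.ker _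
  have h2 : LinearMap.ker (M.range.mkQ ∘ₗ σ) ≤ T.range ⊔ pol.range := by
    intro y hy
    obtain ⟨f, hf⟩ : ∃ f, M f = σ y := (Submodule.Quotient.mk_eq_zero _).1 hy
    obtain ⟨g, hg⟩ := hM f
    obtain ⟨r, hr⟩ := hσpol (y - T g) (by rw [map_sub, ← hf, hg, sub_self])
    exact Submodule.mem_sup.2 ⟨T g, ⟨g, rfl⟩, pol r, ⟨r, rfl⟩, by rw [hr, add_sub_cancel]⟩
  have h3 : (T.range ⊔ pol.range).CoFG := h1.of_le h2
  obtain ⟨G, hG⟩ := Submodule.exists_isCompl (T.range ⊔ pol.range)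
  have hGfin : FiniteDimensional K G := Module.Finite.iff_fg.2 (h3.fg_of_isCompl hG)
  refine Module.Finite.of_surjective (T.range.mkQ ∘ₗ (pol.range ⊔ G).subtype) fun y => ?_
  obtain ⟨y, rfl⟩ := Submodule.Quotient.mk_surjective _ y
  have hy : y ∈ T.range ⊔ (pol.range ⊔ G) := by
    rw [← sup_assoc, hG.sup_eq_top]; trivial
  obtain ⟨u, hu, v, hv, rfl⟩ := Submodule.mem_sup.1 hy
  refine ⟨⟨v, hv⟩, ?_⟩
  refine (Submodule.Quotient.eq _).2 ?_
  simpa using hu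

section Shift

variable {p : ℝ≥0∞} [Fact (1 ≤ p)]

lemma coeFn_toeplitz_fourierLp (hP : ∃ P : LpT p →L[ℂ] LpT p, IsRieszProjection p P) (n : ℕ)
    (f : hardySpace p) :
    ((toeplitz p (fourierLp ∞ n) f : LpT p) : Torus → ℂ) =ᵐ[arc]
      fun x => tpow n x * (f : LpT p) x := by
  have hf := (memHardy_coe f).tpow_mul (k := n) (by omega)
  refine ae_eq_of_fourierCoeff (integrable_LpT p _) (hf.1.integrable Fact.out) fun k => ?_
  rw [fourierCoeff_tpow_mul]
  by_cases hk : 0 ≤ k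
  · lift k to ℕ using hk
    exact coeffH_toeplitz_fourierLp hP n f k
  · rw [(f : hardySpace p).2 _ (by omega)]
    exact Subtype.prop (toeplitz p (fourierLp ∞ n) f) k (by omega)

/-- A function in `H^p` whose first `n` coefficients vanish is divisible by `tⁿ`. -/
lemma jetH_eq_zero_iff (hP : ∃ P : LpT p →L[ℂ] LpT p, IsRieszProjection p P) (n : ℕ)
    (f : hardySpace p) : jetH p n f = 0 ↔ ∃ g, toeplitz p (fourierLp ∞ n) g = f := by
  constructor
  · intro h
    refine ⟨toeplitz p (fourierLp ∞ (-n)) f, coeffH_ext fun k => ?_⟩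
    rw [coeffH_toeplitz_fourierLp hP]
    by_cases hk : n ≤ k
    · rw [← Nat.cast_sub hk, coeffH_toeplitz_fourierLp hP]
      congr 2
      push_cast [hk]; ring
    · rw [coeffH_of_neg (by omega)]
      exact (congrFun h ⟨k, by omega⟩).symm
  · rintro ⟨g, rfl⟩
    funext i
    change coeffH p (i : ℕ) _ = 0
    rw [coeffH_toeplitz_fourierLp hP, coeffH_of_neg (by have := i.2; omega)]

lemma toeplitz_neg_eq_zero_iff (hP : ∃ P : LpT p →L[ℂ] LpT p, IsRieszProjection p P) (m : ℕ)
    (y : hardySpace p) : toeplitz p (fourierLp ∞ (-m)) y = 0 ↔ ∃ r, polyH p m r = y := by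
  constructor
  · intro h
    refine ⟨jetH p m y, coeffH_ext fun k => ?_⟩
    rw [coeffH_polyH]
    split_ifs with hk
    · rfl
    · have := coeffH_toeplitz_fourierLp hP (-m) y (k - m)
      rw [h, map_zero] at this
      rw [this]; congr 2
      push_cast [not_lt.1 hk]; ring
  · rintro ⟨r, rfl⟩
    refine coeffH_ext fun k => ?_
    rw [coeffH_toeplitz_fourierLp hP, map_zero, sub_neg_eq_add, ← Nat.cast_add, coeffH_polyH,
      dif_neg (by omega)]

lemma toeplitz_neg_toeplitz (hP : ∃ P : LpT p →L[ℂ] LpT p, IsRieszProjection p P) (n : ℕ)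
    (f : hardySpace p) :
    toeplitz p (fourierLp ∞ (-n)) (toeplitz p (fourierLp ∞ n) f) = f := by
  refine coeffH_ext fun k => ?_
  rw [coeffH_toeplitz_fourierLp hP, sub_neg_eq_add, ← Nat.cast_add, coeffH_toeplitz_fourierLp hP]
  congr 2; push_cast; ring

end Shift

/-- Shifting the symbols: `a₀ (tⁿ f) + b₀ J(tⁿ f) = t^m (a f + b J f)` for `a₀ = t^{m-n} a`,
`b₀ = t^{m+n} b`. -/
lemma thFun_shift (a b : LpT ∞) (n m : ℤ) (f : Torus → ℂ) :
    thFun (mulOp ∞ (fourierLp ∞ (m - n)) a) (mulOp ∞ (fourierLp ∞ (m + n)) b)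
      (fun x => tpow n x * f x) =ᵐ[arc] fun x => tpow m x * thFun a b f x := by
  filter_upwards [BasicFactorization.ae_mulOp_fourierLp (m - n) a,
    BasicFactorization.ae_mulOp_fourierLp (m + n) b] with x h1 h2
  have h3 : tpow n x * tpow (-n) x = 1 := by rw [← tpow_add, add_neg_cancel, tpow_zero]
  simp only [thFun, h1, h2, flip, tilde, tpow_neg_arg]
  simp only [sub_eq_add_neg, tpow_add]
  linear_combination (tpow m x * a x * f x + tpow m x * b x * tpow (-1) x * f (-x)) * h3

/-- For nonnegative indices, `T(a) + H(b) = T(t^{-m}) (T(a₀) + H(b₀)) T(tⁿ)`, where the middle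
factor has vanishing indices. -/
lemma toeplitz_add_hankel_eq_comp {p : ℝ≥0∞} [Fact (1 ≤ p)]
    (hP : ∃ P : LpT p →L[ℂ] LpT p, IsRieszProjection p P) (a b : LpT ∞) (n m : ℕ)
    (f : hardySpace p) :
    (toeplitz p a + hankel p b) f = toeplitz p (fourierLp ∞ (-m))
      ((toeplitz p (mulOp ∞ (fourierLp ∞ (m - n)) a) + hankel p (mulOp ∞ (fourierLp ∞ (m + n)) b))
        (toeplitz p (fourierLp ∞ n) f)) := by
  refine coeffH_ext fun k => ?_
  rw [coeffH_toeplitz_add_hankel hP, coeffH_toeplitz_fourierLp hP, sub_neg_eq_add, ← Nat.cast_add,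
    coeffH_toeplitz_add_hankel hP]
  have e := coeFn_toeplitz_fourierLp hP n f
  have e2 : thFun (mulOp ∞ (fourierLp ∞ (m - n)) a) (mulOp ∞ (fourierLp ∞ (m + n)) b)
      ((toeplitz p (fourierLp ∞ n) f : LpT p) : Torus → ℂ) =ᵐ[arc]
      thFun (mulOp ∞ (fourierLp ∞ (m - n)) a) (mulOp ∞ (fourierLp ∞ (m + n)) b)
      (fun x => tpow n x * (f : LpT p) x) := by
    filter_upwards [e, ae_neg e] with x h1 h2
    simp only [thFun, flip, tilde, h1, h2]
  rw [fourierCoeff_congr_ae (e2.trans (thFun_shift a b n m _)), fourierCoeff_tpow_mul]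
  congr 1; push_cast; ring
namespace BasicFactorization

variable {p q : ℝ≥0∞} [Fact (1 ≤ p)] {a b c d : LpT ∞} {n m : ℤ} {cp dp : Torus → ℂ}

/-! ### Negative indices -/

/-- For `n < 0` the function `t^{-n-1} (1 - t) c₊⁻¹` lies in the kernel of `T(a) + H(b)`. -/
lemma not_injective_of_neg (h : BasicFactorization p q a b c d n m cp dp) (hn : n < 0)
    (hP : ∃ P : LpT p →L[ℂ] LpT p, IsRieszProjection p P) :
    ¬ Function.Injective (toeplitz p a + hankel p b) := by
  intro hinj
  have hf := h.cp_inv_mem.tpow_mul (k := -n - 1) (by omega)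
  obtain ⟨f, hfe⟩ := hf.exists_coe
  have hF : thFun a b f =ᵐ[arc] 0 := by
    filter_upwards [hfe, ae_neg hfe, h.ae_relations] with x h1 h2
      ⟨⟨ha, hb, hb', hcp, hcp', hdp, hdp'⟩, _, ⟨e1, e2⟩⟩
    have ht := tpow_ne_zero 1 x
    have hs := tpow_ne_zero n x
    have hneg : ∀ k, tpow (-k) x = (tpow k x)⁻¹ := fun k => by
      rw [tpow_eq_zpow (-k), zpow_neg, ← tpow_eq_zpow]
    simp only [thFun, flip, tilde, h1, h2, tpow_neg_arg, Pi.zero_apply]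
    simp only [sub_eq_add_neg, neg_add, neg_neg, tpow_add, hneg]
    field_simp
    linear_combination (1 - tpow 1 x) * e1
  have hf0 : f = 0 := hinj (coeffH_ext fun k => by
    rw [coeffH_toeplitz_add_hankel hP, fourierCoeff_congr_ae hF, map_zero, map_zero]
    simp [fourierCoeff])
  have h0 : ∀ᵐ x ∂arc, False := by
    have h3 : ((f : LpT p) : Torus → ℂ) =ᵐ[arc] 0 := by
      rw [hf0]; exact Lp.coeFn_zero ℂ p arc
    filter_upwards [hfe, h3, ae_one_sub_ne_zero, h.cp_ne_zero] with x h1 h2 h3 h4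
    rw [h2, Pi.zero_apply] at h1
    exact mul_ne_zero (tpow_ne_zero _ x) (mul_ne_zero h3 (inv_ne_zero h4)) h1.symm
  obtain ⟨_, hx⟩ := h0.exists
  exact hx

/-- For `n ≥ 0` and `m < 0` the constant function is not in the range of `T(a) + H(b)`. -/
lemma not_surjective_of_neg (h : BasicFactorization p q a b c d n m cp dp)
    [hpq : p.HolderConjugate q] (hp_top : p ≠ ∞) (hn : 0 ≤ n) (hm : m < 0)
    (hP : ∃ P : LpT p →L[ℂ] LpT p, IsRieszProjection p P) :
    ¬ Function.Surjective (toeplitz p a + hankel p b) := by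
  intro hsurj
  obtain ⟨f, hf⟩ := hsurj (monomialH p 0)
  have hmul : HardyMul p q := hardyMul_of_rieszProjection hp_top hP
  -- If `f` were mapped to `1`, the function `tⁿ f` would lie in the kernel of the operator obtained
  -- by shifting both indices to zero, since multiplication by `t^m` removes the constant term.
  have h0 := h.reduce.ae_eq_zero_of_analytic_part hmul le_rfl le_rfl
    ((memHardy_coe f).tpow_mul hn) (fun k hk => by
      rw [fourierCoeff_congr_ae (thFun_shift a b n m _), fourierCoeff_tpow_mul]
      obtain ⟨l, hl⟩ := Int.eq_ofNat_of_zero_le (show 0 ≤ k - m by omega)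
      rw [hl, ← coeffH_toeplitz_add_hankel hP, hf, coeffH_monomialH, if_neg (by omega)])
  have hf0 : f = 0 := Subtype.ext (Lp.ext (by
    filter_upwards [h0, Lp.coeFn_zero ℂ p arc] with x h1 h2
    rw [Submodule.coe_zero, h2]
    exact (mul_eq_zero.1 h1).resolve_left (tpow_ne_zero n x)))
  have h1 := coeffH_monomialH (p := p) 0 0
  rw [← hf, hf0, map_zero, map_zero] at h1
  simp at h1

/-! ### The finite matrix -/

/-- The triangular Toeplitz matrix of multiplication by `(1 + t) c₊` on jets, with the first row
doubled. It turns the coefficients of `f` into those of the even part of `(1 + t) c₊ f`. -/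
def jetMatrix (cp : Torus → ℂ) (N : ℕ) : Matrix (Fin N) (Fin N) ℂ :=
  Matrix.of fun i j => if j ≤ i then
    (if (i : ℕ) = 0 then 2 else 1) * fourierCoeff (fun x => (1 + tpow 1 x) * cp x) ((i : ℤ) - j)
    else 0

lemma isUnit_jetMatrix (h : BasicFactorization p q a b c d n m cp dp)
    [hpq : p.HolderConjugate q] (hmul : HardyMul p q) (N : ℕ) : IsUnit (jetMatrix cp N) := by
  rw [Matrix.isUnit_iff_isUnit_det, isUnit_iff_ne_zero, Matrix.det_of_isLowerTriangular]
  · refine Finset.prod_ne_zero_iff.2 fun i _ => ?_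
    simp only [jetMatrix, Matrix.of_apply, le_refl, if_true, sub_self]
    refine mul_ne_zero ?_ (h.fourierCoeff_cp_ne_zero hmul)
    split_ifs <;> norm_num
  · intro i j hij
    have : i < j := hij
    simp only [jetMatrix, Matrix.of_apply, if_neg (not_le.2 this)]

lemma jetMatrix_mulVec (h : BasicFactorization p q a b c d n m cp dp)
    [hpq : p.HolderConjugate q] (hmul : HardyMul p q) (N : ℕ) (f : hardySpace p) (i : Fin N) :
    (jetMatrix cp N).mulVec (jetH p N f) i =
      fourierCoeff (fun x => ((1 + tpow 1 x) * cp x) * (f : LpT p) x) i +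
        fourierCoeff (fun x => ((1 + tpow 1 x) * cp x) * (f : LpT p) x) (-i) := by
  have hc := hmul.fourierCoeff_mul (memHardy_coe f) h.cp_mem (i : ℕ)
  simp only [mul_comm (((f : LpT p) : Torus → ℂ) _)] at hc
  have hsum : (jetMatrix cp N).mulVec (jetH p N f) i = (if (i : ℕ) = 0 then 2 else 1) *
      fourierCoeff (fun x => ((1 + tpow 1 x) * cp x) * (f : LpT p) x) (i : ℕ) := by
    rw [hc, Finset.mul_sum]
    have e2 : (Finset.range N).filter (fun j => j ≤ (i : ℕ)) = Finset.range ((i : ℕ) + 1) := by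
      ext j
      have := i.2
      simp only [Finset.mem_filter, Finset.mem_range]; omega
    rw [← e2, Finset.sum_filter, ← Fin.sum_univ_eq_sum_range (fun j : ℕ => if j ≤ i then
      (if (i : ℕ) = 0 then 2 else 1) * (fourierCoeff ((f : LpT p) : Torus → ℂ) j *
        fourierCoeff (fun x => (1 + tpow 1 x) * cp x) ((i : ℕ) - (j : ℤ))) else 0) N]
    change ∑ j, jetMatrix cp N i j * jetH p N f j = _
    refine Finset.sum_congr rfl fun j _ => ?_
    simp only [jetMatrix, Matrix.of_apply, Fin.le_iff_val_le_val]
    split_ifs <;> first | (simp [jetH, coeffH]; done) | (simp [jetH, coeffH]; ring)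
  rw [hsum]
  split_ifs with hi
  · simp [hi]; ring
  · have h0 : fourierCoeff (fun x => ((1 + tpow 1 x) * cp x) * (f : LpT p) x) (-(i : ℕ)) = 0 :=
      hmul.symm _ _ h.cp_mem (memHardy_coe f) _ (by omega)
    rw [h0]; simp

/-- If `(T(a₀) + H(b₀)) f` is a polynomial `r` of degree less than `n = m`, then the even part of
`(1 + t) c₊ f` has coefficients `A y` for some vector `y`, which vanishes only if `r` does. -/
lemma exists_matrixA_mulVec (h : BasicFactorization p q a b c d n n cp dp)
    [hpq : p.HolderConjugate q] (hp_top : p ≠ ∞)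
    (hP : ∃ P : LpT p →L[ℂ] LpT p, IsRieszProjection p P) (hn : 0 ≤ n) {f : hardySpace p}
    {r : Fin n.toNat → ℂ} (hr : (toeplitz p (mulOp ∞ (fourierLp ∞ (n - n)) a) +
      hankel p (mulOp ∞ (fourierLp ∞ (n + n)) b)) f = polyH p n.toNat r) :
    ∃ y : Fin n.toNat → ℂ, (matrixA b n n cp dp).mulVec y =
      (jetMatrix cp n.toNat).mulVec (jetH p n.toNat f) ∧ (y = 0 → r = 0) := by
  have hmul : HardyMul p q := hardyMul_of_rieszProjection hp_top hP
  -- `f₁ = t^{-n} f` need not be analytic, but it solves the kernel equation for `a` and `b`.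
  set f₁ : Torus → ℂ := fun x => tpow (-n) x * (f : LpT p) x with hf₁
  have hf₁m : MemLp f₁ p arc := memLp_bdd_mul (memLp_tpow _ _) (Lp.memLp _)
  have hback : (fun x => tpow n x * f₁ x) = ((f : LpT p) : Torus → ℂ) := by
    funext x
    rw [hf₁, ← mul_assoc, ← tpow_add, add_neg_cancel, tpow_zero, one_mul]
  have hshift := thFun_shift a b n n f₁
  rw [hback] at hshift
  have hcoef : ∀ k : ℕ, fourierCoeff (thFun a b f₁) ((k : ℤ) - n) =
      coeffH p k (polyH p n.toNat r) := fun k => by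
    rw [← fourierCoeff_tpow_mul, ← fourierCoeff_congr_ae hshift, ← hr,
      coeffH_toeplitz_add_hankel hP]
  obtain ⟨y, hy⟩ := h.exists_even_polynomial hmul hf₁m fun k hk => by
    have := hcoef (k + n).toNat
    rw [coeffH_polyH, dif_neg (by omega)] at this
    rw [← this]; congr 1; omega
  refine ⟨fun j => y j, ?_, fun hy0 => ?_⟩
  · funext i
    rw [h.jetMatrix_mulVec hmul]
    have hev := h.fourierCoeff_even_part hf₁m hy i
    have e : (fun x => tpow n x * ((1 + tpow 1 x) * cp x * f₁ x)) =
        fun x => (1 + tpow 1 x) * cp x * (f : LpT p) x := by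
      rw [← hback]; funext x; ring
    rw [e] at hev
    rw [hev, ← Fin.sum_univ_eq_sum_range (fun j : ℕ =>
      (fourierCoeff (rho b n n cp dp) ((i : ℤ) - j) +
      fourierCoeff (rho b n n cp dp) ((i : ℤ) + j)) * y j)]
    rfl
  · have hz : thFun a b f₁ =ᵐ[arc] 0 := by
      filter_upwards [hy] with x hx
      rw [hx, Finset.sum_eq_zero, mul_zero]; rfl
      intro j hj
      have := congrFun hy0 ⟨j, Finset.mem_range.1 hj⟩
      simp only [Pi.zero_apply] at this
      rw [this, zero_mul]
    have : polyH p n.toNat r = 0 := coeffH_ext fun k => by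
      rw [← hcoef, fourierCoeff_congr_ae hz, map_zero]
      simp [fourierCoeff]
    rw [← jetH_polyH r (p := p), this, map_zero]

/-- For nonnegative indices, `T(a) + H(b)` is bijective exactly when `M₀⁻¹` compresses to a
bijection from polynomials of degree less than `m` onto jets of order `n`, where
`M₀ = T(a₀) + H(b₀)`. -/
lemma bijective_iff_of_nonneg (h : BasicFactorization p q a b c d n m cp dp)
    [hpq : p.HolderConjugate q] (hp_one : 1 < p) (hp_top : p ≠ ∞)
    (hP : ∃ P : LpT p →L[ℂ] LpT p, IsRieszProjection p P) (hn : 0 ≤ n) (hm : 0 ≤ m)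
    (hfin : (toeplitz p a + hankel p b).range.CoFG) :
    ∃ M₀ : hardySpace p ≃ₗ[ℂ] hardySpace p,
      (∀ f, M₀ f = (toeplitz p (mulOp ∞ (fourierLp ∞ (m - n)) a) +
        hankel p (mulOp ∞ (fourierLp ∞ (m + n)) b)) f) ∧
      (Function.Bijective (toeplitz p a + hankel p b) ↔
        Function.Bijective (jetH p n.toNat ∘ₗ M₀.symm.toLinearMap ∘ₗ polyH p m.toNat)) := by
  lift n to ℕ using hn
  lift m to ℕ using hm
  simp only [Int.toNat_natCast]
  have hcomp := toeplitz_add_hankel_eq_comp hP a b n m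
  set T := toeplitz p (mulOp ∞ (fourierLp ∞ ((m : ℤ) - n)) a) +
    hankel p (mulOp ∞ (fourierLp ∞ ((m : ℤ) + n)) b) with hT
  have hTfin : T.range.CoFG := cofg_range_of_comp (T : hardySpace p →ₗ[ℂ] hardySpace p)
    (toeplitz p (fourierLp ∞ (-m)) : hardySpace p →ₗ[ℂ] hardySpace p)
    ((toeplitz p a + hankel p b : hardySpace p →L[ℂ] hardySpace p) :
      hardySpace p →ₗ[ℂ] hardySpace p) (polyH p m)
    (fun y hy => (toeplitz_neg_eq_zero_iff hP m y).1 hy) (fun f => ⟨_, hcomp f⟩) hfin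
  have hbij : Function.Bijective T := h.reduce.bijective_of_index_zero hp_one hp_top hP hTfin
  refine ⟨LinearEquiv.ofBijective (T : hardySpace p →ₗ[ℂ] hardySpace p) hbij, fun f => rfl, ?_⟩
  rw [← bijective_comp_iff (LinearEquiv.ofBijective (T : hardySpace p →ₗ[ℂ] hardySpace p) hbij)
    (toeplitz p (fourierLp ∞ n) : hardySpace p →ₗ[ℂ] hardySpace p)
    (toeplitz p (fourierLp ∞ (-m)) : hardySpace p →ₗ[ℂ] hardySpace p) (jetH p n) (polyH p m)
    (Function.LeftInverse.injective (toeplitz_neg_toeplitz hP n)) (jetH_eq_zero_iff hP n)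
    (Function.RightInverse.surjective jetH_polyH)
    (Function.RightInverse.surjective (toeplitz_neg_toeplitz hP m))
    (toeplitz_neg_eq_zero_iff hP m) (Function.LeftInverse.injective jetH_polyH)]
  exact iff_of_eq (congrArg _ (funext hcomp))

/-- The compression of `M₀⁻¹` and the matrix `A` are equivalent up to invertible factors. -/
lemma bijective_compression_iff (h : BasicFactorization p q a b c d n n cp dp)
    [hpq : p.HolderConjugate q] (hp_top : p ≠ ∞)
    (hP : ∃ P : LpT p →L[ℂ] LpT p, IsRieszProjection p P) (hn : 0 ≤ n)
    (M₀ : hardySpace p ≃ₗ[ℂ] hardySpace p)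
    (hM₀ : ∀ f, M₀ f = (toeplitz p (mulOp ∞ (fourierLp ∞ (n - n)) a) +
        hankel p (mulOp ∞ (fourierLp ∞ (n + n)) b)) f) :
    Function.Bijective (jetH p n.toNat ∘ₗ M₀.symm.toLinearMap ∘ₗ polyH p n.toNat) ↔
      IsUnit (matrixA b n n cp dp) := by
  have hmul : HardyMul p q := hardyMul_of_rieszProjection hp_top hP
  have hD := h.isUnit_jetMatrix hmul n.toNat
  set B := jetH p n.toNat ∘ₗ M₀.symm.toLinearMap ∘ₗ polyH p n.toNat with hB
  have hrel : ∀ r, ∃ y : Fin n.toNat → ℂ, (matrixA b n n cp dp).mulVec y =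
      (jetMatrix cp n.toNat).mulVec (B r) ∧ (y = 0 → r = 0) := fun r =>
    h.exists_matrixA_mulVec hp_top hP hn (f := M₀.symm (polyH p n.toNat r))
      (by rw [← hM₀, M₀.apply_symm_apply])
  constructor
  · rintro ⟨-, hsurj⟩
    rw [← Matrix.mulVec_surjective_iff_isUnit]
    intro z
    obtain ⟨w, rfl⟩ := Matrix.mulVec_surjective_iff_isUnit.2 hD z
    obtain ⟨r, rfl⟩ := hsurj w
    obtain ⟨y, hy, -⟩ := hrel r
    exact ⟨y, hy⟩
  · intro hA
    have hinj : Function.Injective B := by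
      rw [injective_iff_map_eq_zero]
      intro r hr
      obtain ⟨y, hy, hy0⟩ := hrel r
      rw [hr, Matrix.mulVec_zero] at hy
      exact hy0 (Matrix.mulVec_injective_iff_isUnit.2 hA (by rw [hy, Matrix.mulVec_zero]))
    exact ⟨hinj, LinearMap.injective_iff_surjective.1 hinj⟩

end BasicFactorization

end ToeplitzHankel

end

open ToeplitzHankel in
theorem corollary4p3 (p q : ENNReal) [Fact (1 ≤ p)] (hp_one : 1 < p) (hp_top : p ≠ ⊤)
    (hpq : p.HolderConjugate q)
    (a b c d : ToeplitzHankel.LpT ⊤) (n m : ℤ) (cp dp : ToeplitzHankel.Torus → ℂ)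
    (hfact : ToeplitzHankel.BasicFactorization p q a b c d n m cp dp)
    (hfred : (ToeplitzHankel.toeplitz p a + ToeplitzHankel.hankel p b).IsFredholm) :
    (ToeplitzHankel.toeplitz p a + ToeplitzHankel.hankel p b).IsInvertible ↔
      (n = 0 ∧ m = 0) ∨
        (n = m ∧ 0 < n ∧ IsUnit (ToeplitzHankel.matrixA b n n cp dp)) := by
  have hP := exists_rieszProjection_of_isFredholm hfred
  have hcomplete : CompleteSpace (hardySpace p) := (isClosed_hardySpace (q := q)).completeSpace_coe
  have hinv : (toeplitz p a + hankel p b).IsInvertible ↔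
      Function.Bijective (toeplitz p a + hankel p b) := by
    constructor
    · rintro ⟨e, he⟩
      rw [← he]
      exact e.bijective
    · intro hb
      exact ⟨ContinuousLinearEquiv.ofBijective _ (LinearMap.ker_eq_bot.2 hb.1)
        (LinearMap.range_eq_top.2 hb.2), ContinuousLinearEquiv.coe_ofBijective _ _ _⟩
  rw [hinv]
  by_cases hn : 0 ≤ n
  swap
  · refine iff_of_false (fun hb => hfact.not_injective_of_neg (not_le.1 hn) hP hb.1) ?_
    omega
  by_cases hm : 0 ≤ m
  swap
  · refine iff_of_false
      (fun hb => hfact.not_surjective_of_neg hp_top hn (not_le.1 hm) hP hb.2) ?_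
    omega
  obtain ⟨M₀, hM₀, hiff⟩ := hfact.bijective_iff_of_nonneg hp_one hp_top hP hn hm hfred.finite_coker
  rw [hiff]
  by_cases hnm : n = m
  · subst hnm
    rw [hfact.bijective_compression_iff hp_top hP hn M₀ hM₀]
    rcases hn.eq_or_lt with h0 | h0
    · subst h0
      have : IsEmpty (Fin (Int.toNat 0)) := inferInstanceAs (IsEmpty (Fin 0))
      have : IsUnit (matrixA b 0 0 cp dp) := by
        rw [Matrix.isUnit_iff_isUnit_det, Matrix.det_isEmpty]; exact isUnit_one
      exact iff_of_true this (Or.inl ⟨rfl, rfl⟩)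
    · simp [h0, h0.ne']
  · refine iff_of_false (fun hb => hnm ?_) (by rintro (h | h) <;> omega)
    have := (LinearEquiv.ofBijective _ hb).finrank_eq
    simp only [Module.finrank_fin_fun] at this
    omega
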